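/- Let $\Omega\subset\mathbb R^d$ be a bounded open set with Lipschitz boundary, let $\partial_u\Omega\neq\emptyset$ and $\partial_q\Omega$ be disjoint measurable subsets of $\partial\Omega$ with $\overline{\partial_u\Omega\cup\partial_q\Omega}=\partial\Omega$, let $I=[0,T]$ with $T>0$, and let $P=P_1\times\dots\times P_{n_p}$ with bounded $P_j\subset\mathbb R$. For each $p\in P$ let $c(\cdot,p)$, $k(\cdot,p)$, $r(\cdot,p)$ be measurable functions on $\Omega$ bounded above and below by positive constants (which may depend on $p$). Let $f_d\in L^2(I;L^2(\Omega))$ and $g_d\in L^2(I;L^2(\partial_q\Omega))$. Let $\mathcal V$ be the space of functions in $H^1(\Omega)$ whose trace vanishes on $\partial_u\Omega$, with the $H^1$ norm, and write $\ell_t(v)=\int_\Omega f_d(t)v\,d\Omega+\int_{\partial_q\Omega}g_d(t)v\,dS$. For each $p$ let $W_p$ be the space of $w\in L^2(I;\mathcal V)$ with $c\,\partial_t w\in L^2(I;\mathcal V^*)$, where $c\,\partial_t w$ is the weak time derivative of the functional $v\mapsto\int_\Omega c\,w(t)v\,d\Omega$, so that $\int_\Omega c\,\partial_t w\,v$ denotes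 a duality pairing; elements of $W_p$ are identified with their representatives in $C([0,T];L^2(\Omega))$. For each $p\in P$ let $u=u(p)\in W_p$ solve the diffusion–reaction problem $$u(0)=0,\qquad \int_I\int_\Omega\big(c\,\partial_t u\,v+k\nabla u\cdot\nabla v+r\,u\,v\big)\,d\Omega\,dt=\int_I\ell_t(v(t))\,dt\quad\text{for all }v\in L^2(I;\mathcal V),$$ and put $q=k\nabla u$, $z=ru$. Write $\|w\|_k^2=\int_\Omega k|\nabla w|^2$, $\|w\|_r^2=\int_\Omega r w^2$, $\|\tau\|_{k^{-1}}^2=\int_\Omega k^{-1}|\tau|^2$, $\|y\|_{r^{-1}}^2=\int_\Omega r^{-1}y^2$, $|||\cdot|||_\square^2=\int_I\|\cdot\|_\square^2\,dt$, $\|w\|_c^2=\int_\Omega c\,w(T)^2$, and $|||w|||^2=|||w|||_k^2+|||w|||_r^2+\|w\|_c^2$. (1) Fix $p\in P$ and let $(\hat u,\hat q,\hat z)$ be any admissible triplet, i.e. $\hat u\in W_p$ (so $\hat u=0$ on $\partial_u\Omega$), $\hat u(0)=0$, $\hat q\in L^2(I;L^2(\Omega)^d)$, $\hat z\in L^2(I;L^2(\Omega))$,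 and for a.e. $t\in I$ $$\int_\Omega\big(c\,\partial_t\hat u\,v+\hat q\cdot\nabla v+\hat z\,v\big)\,d\Omega=\ell_t(v)\quad\text{for all }v\in\mathcal V.$$ Let $E_{\mathrm{CRE}}^2=\int_I\int_\Omega\big(\tfrac1k|\hat q-k\nabla\hat u|^2+\tfrac1r(\hat z-r\hat u)^2\big)\,d\Omega\,dt$. Then $$E_{\mathrm{CRE}}^2=|||q-\hat q|||_{k^{-1}}^2+|||z-\hat z|||_{r^{-1}}^2+|||u-\hat u|||_k^2+|||u-\hat u|||_r^2+\|u-\hat u\|_c^2\ \ge\ |||u-\hat u|||^2,$$ and, with $\hat q^*=\tfrac12(\hat q+k\nabla\hat u)$ and $\hat z^*=\tfrac12(\hat z+r\hat u)$, $$\tfrac12E_{\mathrm{CRE}}^2=2\,|||q-\hat q^*|||_{k^{-1}}^2+2\,|||z-\hat z^*|||_{r^{-1}}^2+\|u-\hat u\|_c^2.$$ (2) Let $u_m(x,t,p)=\sum_{i=1}^m\psi_i(x)\lambda_i(t)\prod_{j=1}^{n_p}\gamma_{j,i}(p_j)$ be a separated (PGD) approximation with $\psi_i\in\mathcal V$,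 $\lambda_i\in H^1(I)$, $\gamma_{j,i}\in L^2(P_j)$ and $u_m(\cdot,0,p)=0$ for all $p\in P$, and for each $p\in P$ let $\hat q_m\in L^2(I;L^2(\Omega)^d)$ be a flux in full equilibrium with $u_m$: for a.e. $t\in I$, $$\int_\Omega\big(c\,\partial_tu_m\,v+\hat q_m\cdot\nabla v+r\,u_m\,v\big)\,d\Omega=\ell_t(v)\quad\text{for all }v\in\mathcal V.$$ Then for every $p\in P$ the quantity $E_{\mathrm{CRE}}$ of the triplet $(u_m,\hat q_m,r u_m)$ satisfies $$E_{\mathrm{CRE}}^2=|||\hat q_m-k\nabla u_m|||_{k^{-1}}^2\ \ge\ |||u-u_m|||_k^2+|||u-u_m|||_r^2+\|u-u_m\|_c^2=|||u-u_m|||^2.$$ -/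

import Mathlib

open MeasureTheory Set
open scoped ContDiff NNReal RealInnerProductSpace

namespace CRE

/-- Physical space `ℝ^d` with its Euclidean norm. -/
abbrev Space (d : ℕ) : Type := EuclideanSpace ℝ (Fin d)

/-- `L²(Ω)`. -/
abbrev ScalarL2 {d : ℕ} (Ω : Set (Space d)) : Type := Lp ℝ 2 (volume.restrict Ω)

/-- `L²(Ω; ℝ^d)`. -/
abbrev VectorL2 {d : ℕ} (Ω : Set (Space d)) : Type := Lp (Space d) 2 (volume.restrict Ω)

/-- Pairs (scalar field, vector field) with the norm `(‖v‖² + ‖w‖²)^(1/2)`; on pairs `(v, ∇v)` this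
is the norm of `H¹(Ω)`. -/
abbrev FieldPair {d : ℕ} (Ω : Set (Space d)) : Type := WithLp 2 (ScalarL2 Ω × VectorL2 Ω)

/-- Surface measure on `∂Ω`: the (normalized) `(d-1)`-dimensional Hausdorff measure. -/
noncomputable def surfaceMeasure {d : ℕ} (Ω : Set (Space d)) : Measure (Space d) :=
  (Measure.euclideanHausdorffMeasure (d - 1)).restrict (frontier Ω)

/-- `L²(∂Ω)`. -/
abbrev BoundaryL2 {d : ℕ} (Ω : Set (Space d)) : Type := Lp ℝ 2 (surfaceMeasure Ω)

/-- Bounded open sets with Lipschitz boundary: near each boundary point, `Ω` is the strict epigraph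
of a Lipschitz function over a hyperplane. -/
structure IsLipschitzDomain {d : ℕ} (Ω : Set (Space d)) : Prop where
  isOpen : IsOpen Ω
  isBounded : Bornology.IsBounded Ω
  locally_epigraph : ∀ x ∈ frontier Ω, ∃ ν : Space d, ‖ν‖ = 1 ∧
    ∃ (K : ℝ≥0) (h : (ℝ ∙ ν)ᗮ → ℝ), LipschitzWith K h ∧
      ∃ ρ > 0, ∀ y ∈ Metric.ball x ρ,
        (y ∈ Ω ↔ h ((ℝ ∙ ν)ᗮ.orthogonalProjectionOnto y) < ⟪ν, y⟫)

/-- `G` is the weak (distributional) gradient of `v` in `Ω`. -/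
def HasWeakGradient {d : ℕ} (Ω : Set (Space d)) (v : ScalarL2 Ω) (G : VectorL2 Ω) : Prop :=
  ∀ φ : Space d → ℝ, ContDiff ℝ ∞ φ → HasCompactSupport φ → tsupport φ ⊆ Ω → ∀ a : Space d,
    ∫ x in Ω, v x * fderiv ℝ φ x a = - ∫ x in Ω, ⟪G x, a⟫ * φ x

theorem integrable_mul_test {d : ℕ} {Ω : Set (Space d)} {v : Space d → ℝ}
    (hv : MemLp v 2 (volume.restrict Ω)) {φ : Space d → ℝ} (hφ : Continuous φ)
    (hc : HasCompactSupport φ) : Integrable (fun x => v x * φ x) (volume.restrict Ω) :=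
  MemLp.integrable_mul (p := 2) (q := 2) hv (hφ.memLp_of_hasCompactSupport hc)

/-- The Sobolev space `H¹(Ω)`, its elements being the pairs `(v, ∇v)`. -/
def H1 {d : ℕ} (Ω : Set (Space d)) : Submodule ℝ (FieldPair Ω) where
  carrier := {w | HasWeakGradient Ω w.fst w.snd}
  zero_mem' := by
    intro φ _ _ _ a
    have h1 : (fun x => (((0 : FieldPair Ω).fst : ScalarL2 Ω) : Space d → ℝ) x * fderiv ℝ φ x a)
        =ᵐ[volume.restrict Ω] 0 := by
      filter_upwards [Lp.coeFn_zero ℝ 2 (volume.restrict Ω)] with x hx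
      simp only [WithLp.zero_fst, hx, Pi.zero_apply, zero_mul]
    have h2 : (fun x => ⟪(((0 : FieldPair Ω).snd : VectorL2 Ω) : Space d → Space d) x, a⟫ * φ x)
        =ᵐ[volume.restrict Ω] 0 := by
      filter_upwards [Lp.coeFn_zero (Space d) 2 (volume.restrict Ω)] with x hx
      simp only [WithLp.zero_snd, hx, Pi.zero_apply, inner_zero_left, zero_mul]
    rw [integral_congr_ae h1, integral_congr_ae h2]
    simp
  add_mem' := by
    intro w w' hw hw' φ hφ hc hs a
    have hd : Continuous fun x => fderiv ℝ φ x a :=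
      (hφ.continuous_fderiv (by simp)).clm_apply continuous_const
    have hdc : HasCompactSupport fun x => fderiv ℝ φ x a := hc.fderiv_apply (𝕜 := ℝ) a
    have h1 : (fun x => ((w + w').fst : Space d → ℝ) x * fderiv ℝ φ x a)
        =ᵐ[volume.restrict Ω] fun x => w.fst x * fderiv ℝ φ x a + w'.fst x * fderiv ℝ φ x a := by
      filter_upwards [Lp.coeFn_add w.fst w'.fst] with x hx
      simp only [WithLp.add_fst, hx, Pi.add_apply]
      ring
    have h2 : (fun x => ⟪((w + w').snd : Space d → Space d) x, a⟫ * φ x)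
        =ᵐ[volume.restrict Ω] fun x => ⟪w.snd x, a⟫ * φ x + ⟪w'.snd x, a⟫ * φ x := by
      filter_upwards [Lp.coeFn_add w.snd w'.snd] with x hx
      simp only [WithLp.add_snd, hx, Pi.add_apply, inner_add_left]
      ring
    rw [integral_congr_ae h1, integral_congr_ae h2,
      integral_add (integrable_mul_test (Lp.memLp _) hd hdc)
        (integrable_mul_test (Lp.memLp _) hd hdc),
      integral_add (integrable_mul_test ((Lp.memLp w.snd).inner_const a) hφ.continuous hc)
        (integrable_mul_test ((Lp.memLp w'.snd).inner_const a) hφ.continuous hc),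
      hw φ hφ hc hs a, hw' φ hφ hc hs a]
    ring
  smul_mem' := by
    intro s w hw φ hφ hc hs a
    have h1 : (fun x => ((s • w).fst : Space d → ℝ) x * fderiv ℝ φ x a)
        =ᵐ[volume.restrict Ω] fun x => s * (w.fst x * fderiv ℝ φ x a) := by
      filter_upwards [Lp.coeFn_smul s w.fst] with x hx
      simp only [WithLp.smul_fst, hx, Pi.smul_apply, smul_eq_mul]
      ring
    have h2 : (fun x => ⟪((s • w).snd : Space d → Space d) x, a⟫ * φ x)
        =ᵐ[volume.restrict Ω] fun x => s * (⟪w.snd x, a⟫ * φ x) := by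
      filter_upwards [Lp.coeFn_smul s w.snd] with x hx
      simp only [WithLp.smul_snd, hx, Pi.smul_apply, real_inner_smul_left]
      ring
    rw [integral_congr_ae h1, integral_congr_ae h2, integral_const_mul, integral_const_mul,
      hw φ hφ hc hs a]
    ring

/-- The graph of the classical restriction map: triples `((φ|_Ω, ∇φ|_Ω), φ|_∂Ω)` for smooth
`φ : ℝ^d → ℝ` (with `φ|_Ω`, `∇φ|_Ω`, `φ|_∂Ω` square integrable, as is automatic for bounded
Lipschitz `Ω`). -/
noncomputable def smoothTraceGraph {d : ℕ} (Ω : Set (Space d)) :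
    Submodule ℝ (FieldPair Ω × BoundaryL2 Ω) where
  carrier := {z | ∃ φ : Space d → ℝ, ContDiff ℝ ∞ φ ∧
    (∀ᵐ x ∂volume.restrict Ω, z.1.fst x = φ x) ∧
    (∀ᵐ x ∂volume.restrict Ω, z.1.snd x = gradient φ x) ∧
    (∀ᵐ x ∂surfaceMeasure Ω, z.2 x = φ x)}
  zero_mem' := by
    refine ⟨0, contDiff_const, ?_, ?_, ?_⟩
    · filter_upwards [Lp.coeFn_zero ℝ 2 (volume.restrict Ω)] with x hx
      simp only [Prod.fst_zero, WithLp.zero_fst, hx, Pi.zero_apply]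
    · filter_upwards [Lp.coeFn_zero (Space d) 2 (volume.restrict Ω)] with x hx
      simp only [Prod.fst_zero, WithLp.zero_snd, hx, Pi.zero_apply]
      simp [gradient]
    · filter_upwards [Lp.coeFn_zero ℝ 2 (surfaceMeasure Ω)] with x hx
      simp only [Prod.snd_zero, hx, Pi.zero_apply]
  add_mem' := by
    rintro z z' ⟨φ, hφ, h1, h2, h3⟩ ⟨φ', hφ', h1', h2', h3'⟩
    refine ⟨φ + φ', hφ.add hφ', ?_, ?_, ?_⟩
    · filter_upwards [Lp.coeFn_add z.1.fst z'.1.fst, h1, h1'] with x hx e e'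
      simp only [Prod.fst_add, WithLp.add_fst, hx, Pi.add_apply, e, e']
    · filter_upwards [Lp.coeFn_add z.1.snd z'.1.snd, h2, h2'] with x hx e e'
      have hd := (hφ.differentiable (by simp)) x
      have hd' := (hφ'.differentiable (by simp)) x
      simp only [Prod.fst_add, WithLp.add_snd, hx, Pi.add_apply, e, e', gradient,
        fderiv_add hd hd', map_add]
    · filter_upwards [Lp.coeFn_add z.2 z'.2, h3, h3'] with x hx e e'
      simp only [Prod.snd_add, hx, Pi.add_apply, e, e']
  smul_mem' := by
    rintro s z ⟨φ, hφ, h1, h2, h3⟩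
    refine ⟨s • φ, contDiff_const.smul hφ, ?_, ?_, ?_⟩
    · filter_upwards [Lp.coeFn_smul s z.1.fst, h1] with x hx e
      simp [hx, e]
    · filter_upwards [Lp.coeFn_smul s z.1.snd, h2] with x hx e
      have hd := (hφ.differentiable (by simp)) x
      simp [hx, e, gradient, fderiv_const_smul hd s]
    · filter_upwards [Lp.coeFn_smul s z.2, h3] with x hx e
      simp [hx, e]

/-- `τ` is the trace on `∂Ω` of the `H¹` function `w = (v, ∇v)`: the closure, in
`H¹(Ω) × L²(∂Ω)`, of the restriction map on smooth functions. For a bounded Lipschitz `Ω`, every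
`w` in `H¹(Ω)` has exactly one trace. -/
def IsTrace {d : ℕ} (Ω : Set (Space d)) (w : FieldPair Ω) (τ : BoundaryL2 Ω) : Prop :=
  (w, τ) ∈ (smoothTraceGraph Ω).topologicalClosure

open Classical in
/-- The trace operator. -/
noncomputable def trace {d : ℕ} {Ω : Set (Space d)} (w : FieldPair Ω) : BoundaryL2 Ω :=
  if h : ∃ τ, IsTrace Ω w τ then h.choose else 0

/-- The space `𝒱` of the functions in `H¹(Ω)` with zero trace on `Γu`, with the norm of `H¹(Ω)`. -/
noncomputable def V {d : ℕ} (Ω Γu : Set (Space d)) : Submodule ℝ (FieldPair Ω) where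
  carrier := {w | w ∈ H1 Ω ∧ ∃ τ : BoundaryL2 Ω, IsTrace Ω w τ ∧
    ∀ᵐ x ∂(surfaceMeasure Ω).restrict Γu, τ x = 0}
  zero_mem' := by
    refine ⟨Submodule.zero_mem _, 0, Submodule.zero_mem _, ?_⟩
    filter_upwards [ae_restrict_of_ae (Lp.coeFn_zero ℝ 2 (surfaceMeasure Ω))] with x hx
    simp only [hx, Pi.zero_apply]
  add_mem' := by
    rintro w w' ⟨hw, τ, hτ, h0⟩ ⟨hw', τ', hτ', h0'⟩
    refine ⟨Submodule.add_mem _ hw hw', τ + τ', Submodule.add_mem _ hτ hτ', ?_⟩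
    filter_upwards [ae_restrict_of_ae (Lp.coeFn_add τ τ'), h0, h0'] with x hx e e'
    simp only [hx, Pi.add_apply, e, e', add_zero]
  smul_mem' := by
    rintro s w ⟨hw, τ, hτ, h0⟩
    refine ⟨Submodule.smul_mem _ s hw, s • τ, Submodule.smul_mem _ s hτ, ?_⟩
    filter_upwards [ae_restrict_of_ae (Lp.coeFn_smul s τ), h0] with x hx e
    simp [hx, e]

/-- The function `v` underlying an element of `𝒱`. -/
noncomputable def fn {d : ℕ} {Ω Γu : Set (Space d)} (v : V Ω Γu) : ScalarL2 Ω :=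
  (v : FieldPair Ω).fst

/-- The weak gradient `∇v` of an element of `𝒱`. -/
noncomputable def grad {d : ℕ} {Ω Γu : Set (Space d)} (v : V Ω Γu) : VectorL2 Ω :=
  (v : FieldPair Ω).snd

/-- Lebesgue measure on the time interval `I = [0, T]`. -/
noncomputable def timeMeasure (T : ℝ) : Measure ℝ := volume.restrict (Icc 0 T)

/-- Coefficients in `Ω`: measurable, and bounded above and below by positive constants. -/
def IsPositiveCoefficient {d : ℕ} (Ω : Set (Space d)) (w : Space d → ℝ) : Prop :=
  AEMeasurable w (volume.restrict Ω) ∧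
    ∃ α β : ℝ, 0 < α ∧ ∀ᵐ x ∂volume.restrict Ω, α ≤ w x ∧ w x ≤ β

/-- Functions `u ∈ L²(I; 𝒱)` with `c ∂u/∂t ∈ L²(I; 𝒱*)`. The product `c ∂u/∂t` is the
weak time derivative of the functional `v ↦ ∫_Ω c u(t) v` (recall that `c` is independent of
time), so the duality pairing extends the inner product of `L²(Ω)`. As usual such a function is
identified with its representative in `C([0, T]; L²(Ω))`, which gives the values at `t = 0` and
`t = T`. -/
structure ParabolicSpace {d : ℕ} (Ω Γu : Set (Space d)) (T : ℝ) (c : Space d → ℝ) where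
  /-- The function, as an element of `L²(I; 𝒱)`. -/
  toFun : ℝ → V Ω Γu
  /-- The functional `c ∂u/∂t` in `L²(I; 𝒱*)`. -/
  cdt : ℝ → StrongDual ℝ (V Ω Γu)
  /-- The continuous representative with values in `L²(Ω)`. -/
  rep : ℝ → ScalarL2 Ω
  memLp_toFun : MemLp toFun 2 (timeMeasure T)
  memLp_cdt : MemLp cdt 2 (timeMeasure T)
  continuousOn_rep : ContinuousOn rep (Icc 0 T)
  rep_ae_eq : ∀ᵐ t ∂timeMeasure T, rep t = fn (toFun t)
  weak_derivative : ∀ φ : ℝ → ℝ, ContDiff ℝ ∞ φ → HasCompactSupport φ → tsupport φ ⊆ Ioo 0 T →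
    ∀ v : V Ω Γu,
      ∫ t, deriv φ t * (∫ x in Ω, c x * fn (toFun t) x * fn v x) ∂timeMeasure T
        = - ∫ t, φ t * cdt t v ∂timeMeasure T

/-- The loading `∫_Ω f v + ∫_Γq g v dS` at a given time. -/
noncomputable def load {d : ℕ} {Ω Γu : Set (Space d)} (Γq : Set (Space d)) (f : ScalarL2 Ω)
    (g : Lp ℝ 2 ((surfaceMeasure Ω).restrict Γq)) (v : V Ω Γu) : ℝ :=
  (∫ x in Ω, f x * fn v x) + ∫ x in Γq, g x * trace (v : FieldPair Ω) x ∂surfaceMeasure Ω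

/-- `u` solves the space-time weak formulation: `u(0) = 0` and `b(u, v) = l(v)` for all
`v ∈ L²(I; 𝒱)`. -/
def IsWeakSolution {d : ℕ} {Ω Γu Γq : Set (Space d)} {T : ℝ} {c : Space d → ℝ}
    (k r : Space d → ℝ) (f : ℝ → ScalarL2 Ω)
    (g : ℝ → Lp ℝ 2 ((surfaceMeasure Ω).restrict Γq)) (u : ParabolicSpace Ω Γu T c) : Prop :=
  u.rep 0 = 0 ∧
  ∀ v : ℝ → V Ω Γu, MemLp v 2 (timeMeasure T) →
    ∫ t, (u.cdt t (v t) + ∫ x in Ω, (k x * ⟪grad (u.toFun t) x, grad (v t) x⟫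
        + r x * fn (u.toFun t) x * fn (v t) x)) ∂timeMeasure T
      = ∫ t, load Γq (f t) (g t) (v t) ∂timeMeasure T

/-- Admissible triplets `(û, q̂, ẑ)`: zero initial data, zero Dirichlet data on `Γu` (through the
values in `𝒱`), and weak equilibrium in space at (almost) every time. -/
structure IsAdmissible {d : ℕ} {Ω Γu Γq : Set (Space d)} {T : ℝ} {c : Space d → ℝ}
    (f : ℝ → ScalarL2 Ω) (g : ℝ → Lp ℝ 2 ((surfaceMeasure Ω).restrict Γq))
    (û : ParabolicSpace Ω Γu T c) (q : ℝ → VectorL2 Ω) (z : ℝ → ScalarL2 Ω) : Prop where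
  initial : û.rep 0 = 0
  memLp_q : MemLp q 2 (timeMeasure T)
  memLp_z : MemLp z 2 (timeMeasure T)
  equilibrium : ∀ᵐ t ∂timeMeasure T, ∀ v : V Ω Γu,
    û.cdt t v + ∫ x in Ω, (⟪q t x, grad v x⟫ + z t x * fn v x) = load Γq (f t) (g t) v

/-- The weighted squared norm `∫_Ω w ‖F‖²`, for scalar or vector fields `F`. -/
noncomputable def normSq {d : ℕ} {G : Type*} [NormedAddCommGroup G] (Ω : Set (Space d))
    (w : Space d → ℝ) (F : Space d → G) : ℝ :=
  ∫ x in Ω, w x * ‖F x‖ ^ 2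

/-- The space-time weighted squared norm `∫_I ∫_Ω w ‖F‖²`. -/
noncomputable def triNormSq {d : ℕ} {G : Type*} [NormedAddCommGroup G] (Ω : Set (Space d)) (T : ℝ)
    (w : Space d → ℝ) (F : ℝ → Space d → G) : ℝ :=
  ∫ t, normSq Ω w (F t) ∂timeMeasure T

/-- The squared constitutive relation error `E_CRE²` of `(û, q̂, ẑ)`:
`∫_I ∫_Ω (k⁻¹ ‖q̂ - k ∇û‖² + r⁻¹ (ẑ - r û)²)`. -/
noncomputable def creSq {d : ℕ} {Ω Γu : Set (Space d)} (T : ℝ) (k r : Space d → ℝ)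
    (û : ℝ → V Ω Γu) (q : ℝ → Space d → Space d) (z : ℝ → Space d → ℝ) : ℝ :=
  ∫ t, (∫ x in Ω, ((1 / k x) * ‖q t x - k x • grad (û t) x‖ ^ 2
    + (1 / r x) * (z t x - r x * fn (û t) x) ^ 2)) ∂timeMeasure T

/-- The squared energy norm `|||e|||² = |||e|||_k² + |||e|||_r² + ∫_Ω c e(T)²`, the final value
`e(T)` being given as `eT`. -/
noncomputable def energyNormSq {d : ℕ} {Ω Γu : Set (Space d)} (T : ℝ) (c k r : Space d → ℝ)
    (e : ℝ → V Ω Γu) (eT : ScalarL2 Ω) : ℝ :=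
  triNormSq Ω T k (fun t => grad (e t)) + triNormSq Ω T r (fun t => fn (e t)) + normSq Ω c eT

/-- Separated (PGD) representations
`u_m(x, t, p) = ∑ i, ψ_i(x) λ_i(t) ∏ j, γ_{j,i}(p_j)`, vanishing at `t = 0`, with space modes in `𝒱`,
time modes in `H¹(I)` and parameter modes in `L²(P_j)`. -/
structure PGDApproximation {d np : ℕ} (Ω Γu : Set (Space d)) (T : ℝ) (P : Fin np → Set ℝ)
    (m : ℕ) where
  /-- Space modes. -/
  space : Fin m → V Ω Γu
  /-- Time modes. -/
  time : Fin m → ℝ → ℝ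
  /-- Parameter modes. -/
  param : Fin m → Fin np → ℝ → ℝ
  time_ac : ∀ i, AbsolutelyContinuousOnInterval (time i) 0 T
  time_deriv : ∀ i, MemLp (deriv (time i)) 2 (timeMeasure T)
  param_memLp : ∀ i j, MemLp (param i j) 2 (volume.restrict (P j))
  initial : ∀ p ∈ Set.univ.pi P, ∑ i, (time i 0 * ∏ j, param i j (p j)) • space i = 0

/-- The value `u_m(·, t, p) ∈ 𝒱`. -/
noncomputable def PGDApproximation.eval {d np m : ℕ} {Ω Γu : Set (Space d)} {T : ℝ}
    {P : Fin np → Set ℝ} (U : PGDApproximation Ω Γu T P m) (p : Fin np → ℝ) (t : ℝ) : V Ω Γu :=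
  ∑ i, (U.time i t * ∏ j, U.param i j (p j)) • U.space i

/-- The time derivative `∂u_m/∂t (·, t, p) ∈ 𝒱`. -/
noncomputable def PGDApproximation.evalDeriv {d np m : ℕ} {Ω Γu : Set (Space d)} {T : ℝ}
    {P : Fin np → Set ℝ} (U : PGDApproximation Ω Γu T P m) (p : Fin np → ℝ) (t : ℝ) : V Ω Γu :=
  ∑ i, (deriv (U.time i) t * ∏ j, U.param i j (p j)) • U.space i

/-- The flux `q̂_m` (for the parameter value `p`) is in full weak equilibrium with `u_m`. -/
structure IsEquilibratedFlux {d np m : ℕ} {Ω Γu Γq : Set (Space d)} {T : ℝ}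
    {P : Fin np → Set ℝ} (c r : Space d → ℝ) (f : ℝ → ScalarL2 Ω)
    (g : ℝ → Lp ℝ 2 ((surfaceMeasure Ω).restrict Γq)) (U : PGDApproximation Ω Γu T P m)
    (p : Fin np → ℝ) (q : ℝ → VectorL2 Ω) : Prop where
  memLp_q : MemLp q 2 (timeMeasure T)
  equilibrium : ∀ᵐ t ∂timeMeasure T, ∀ v : V Ω Γu,
    ∫ x in Ω, (c x * fn (U.evalDeriv p t) x * fn v x + ⟪q t x, grad v x⟫
        + r x * fn (U.eval p t) x * fn v x) = load Γq (f t) (g t) v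

end CRE

open CRE

/-!
Collect the two fields of a function into `(u, ∇u)` and let `M` multiply by `(r, k)`, so that the
exact flux is `M u`. For a flux `σ` in equilibrium and an approximation `v`, put `a = M u - σ` and
`b = M (u - v)`. Then `σ - M v = b - a`, and the error of the averaged flux is `(a + b) / 2`.
Expanding `⟪M⁻¹ ·, ·⟫` at these two vectors produces both identities, up to the cross term
`⟪M⁻¹ a, b⟫ = ⟪a, u - v⟫`. Subtracting the equilibrium equation from the weak formulation and
testing with `u - v` turns its time integral into `-∫ ⟨c ∂(u - v)/∂t, u - v⟩`, which is
`-‖u - v‖_c² / 2` by the energy identity of Lions and Magenes. The latter is obtained by averaging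
over `t` the increments of the energy over a time step `h` and letting `h` tend to `0`.
-/

namespace CRE

section WeakDerivative

/-- Smooth functions with compact support in the open interval `(a, b)`. -/
structure IsTestFunction (a b : ℝ) (φ : ℝ → ℝ) : Prop where
  contDiff : ContDiff ℝ ∞ φ
  hasCompactSupport : HasCompactSupport φ
  tsupport_subset : tsupport φ ⊆ Ioo a b

/-- `F` is the weak derivative of `h` on the interval `[a, b]`. -/
def HasWeakDeriv (a b : ℝ) (h F : ℝ → ℝ) : Prop :=
  ∀ φ, IsTestFunction a b φ →
    ∫ t in Icc a b, deriv φ t * h t = -∫ t in Icc a b, φ t * F t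

variable {a b : ℝ} {φ ψ h F : ℝ → ℝ}

namespace IsTestFunction

theorem continuous (hφ : IsTestFunction a b φ) : Continuous φ :=
  hφ.contDiff.continuous

theorem continuous_deriv (hφ : IsTestFunction a b φ) : Continuous (deriv φ) :=
  hφ.contDiff.continuous_deriv (by simp)

theorem apply_eq_zero (hφ : IsTestFunction a b φ) {x : ℝ} (hx : x ∉ Ioo a b) : φ x = 0 :=
  image_eq_zero_of_notMem_tsupport fun h => hx (hφ.tsupport_subset h)

theorem integrableOn_mul (hφ : IsTestFunction a b φ) (hh : IntegrableOn h (Icc a b)) :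
    IntegrableOn (fun t => φ t * h t) (Icc a b) :=
  hh.continuousOn_mul hφ.continuous.continuousOn isCompact_Icc

theorem integrableOn_deriv_mul (hφ : IsTestFunction a b φ) (hh : IntegrableOn h (Icc a b)) :
    IntegrableOn (fun t => deriv φ t * h t) (Icc a b) :=
  hh.continuousOn_mul hφ.continuous_deriv.continuousOn isCompact_Icc

theorem setIntegral_mul (hφ : IsTestFunction a b φ) (h : ℝ → ℝ) :
    ∫ t in Icc a b, φ t * h t = ∫ t, φ t * h t :=
  setIntegral_eq_integral_of_forall_compl_eq_zero fun x hx => by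
    rw [hφ.apply_eq_zero fun hx' => hx (Ioo_subset_Icc_self hx'), zero_mul]

theorem sub (hφ : IsTestFunction a b φ) (hψ : IsTestFunction a b ψ) :
    IsTestFunction a b fun t => φ t - ψ t :=
  ⟨hφ.contDiff.sub hψ.contDiff, hφ.hasCompactSupport.sub hψ.hasCompactSupport,
    (tsupport_sub φ ψ).trans (union_subset hφ.tsupport_subset hψ.tsupport_subset)⟩

theorem const_mul (hφ : IsTestFunction a b φ) (C : ℝ) : IsTestFunction a b fun t => C * φ t :=
  ⟨contDiff_const.mul hφ.contDiff, hφ.hasCompactSupport.mul_left (f := fun _ => C),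
    (tsupport_mul_subset_right (f := fun _ => C)).trans hφ.tsupport_subset⟩

theorem exists_tsupport_subset_Icc (hφ : IsTestFunction a b φ) :
    ∃ c d, tsupport φ ⊆ Icc c d ∧ Icc c d ⊆ Ioo a b := by
  obtain hempty | hne := (tsupport φ).eq_empty_or_nonempty
  · exact ⟨1, 0, by simp [hempty]⟩
  · have hcompact : IsCompact (tsupport φ) := hφ.hasCompactSupport
    exact ⟨sInf (tsupport φ), sSup (tsupport φ), hcompact.isBounded.subset_Icc_sInf_sSup,
      Icc_subset_Ioo (hφ.tsupport_subset (hcompact.sInf_mem hne)).1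
        (hφ.tsupport_subset (hcompact.sSup_mem hne)).2⟩

theorem primitive_eq_zero (hψ : IsTestFunction a b ψ) (h0 : ∫ x, ψ x = 0) {c d x : ℝ}
    (hψcd : tsupport ψ ⊆ Icc c d) (hx : x ∉ Icc c d) : ∫ y in a..x, ψ y = 0 := by
  obtain hxc | hdx : x < c ∨ d < x := by simpa only [mem_Icc, not_and_or, not_le] using hx
  · refine (intervalIntegral.integral_congr fun y hy => ?_).trans intervalIntegral.integral_zero
    refine image_eq_zero_of_notMem_tsupport fun hψy => hy.2.not_gt ?_
    exact max_lt (hψ.tsupport_subset hψy).1 (hxc.trans_le (hψcd hψy).1)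
  · rw [intervalIntegral.integral_eq_integral_of_support_subset, h0]
    intro y hy
    have hψy := subset_tsupport ψ hy
    exact ⟨(hψ.tsupport_subset hψy).1, (hψcd hψy).2.trans hdx.le⟩

theorem primitive (hψ : IsTestFunction a b ψ) (h0 : ∫ x, ψ x = 0) :
    IsTestFunction a b fun x => ∫ y in a..x, ψ y := by
  obtain ⟨c, d, hψcd, hcd⟩ := hψ.exists_tsupport_subset_Icc
  have hsupport : tsupport (fun x => ∫ y in a..x, ψ y) ⊆ Icc c d :=
    closure_minimal (fun x hx => by_contra fun hxcd => hx (hψ.primitive_eq_zero h0 hψcd hxcd))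
      isClosed_Icc
  refine ⟨?_, isCompact_Icc.of_isClosed_subset (isClosed_tsupport _) hsupport, hsupport.trans hcd⟩
  rw [contDiff_infty_iff_deriv, funext (hψ.continuous.deriv_integral ψ a)]
  exact ⟨fun x => (hψ.continuous.integral_hasStrictDerivAt a x).hasDerivAt.differentiableAt,
    hψ.contDiff⟩

theorem exists_integral_eq_one (hab : a < b) : ∃ ρ, IsTestFunction a b ρ ∧ ∫ x, ρ x = 1 := by
  let bump : ContDiffBump ((a + b) / 2) :=
    ⟨(b - a) / 8, (b - a) / 4, by linarith, by linarith⟩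
  refine ⟨bump.normed volume, ⟨bump.contDiff_normed, bump.hasCompactSupport_normed, ?_⟩,
    bump.integral_normed⟩
  rw [bump.tsupport_normed_eq, Real.closedBall_eq_Icc]
  intro x hx
  simp only [bump, mem_Icc] at hx
  constructor <;> linarith

end IsTestFunction

namespace HasWeakDeriv

theorem sub {h₁ h₂ F₁ F₂ : ℝ → ℝ} (H₁ : HasWeakDeriv a b h₁ F₁) (H₂ : HasWeakDeriv a b h₂ F₂)
    (hh₁ : IntegrableOn h₁ (Icc a b)) (hh₂ : IntegrableOn h₂ (Icc a b))
    (hF₁ : IntegrableOn F₁ (Icc a b)) (hF₂ : IntegrableOn F₂ (Icc a b)) :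
    HasWeakDeriv a b (fun t => h₁ t - h₂ t) fun t => F₁ t - F₂ t := by
  intro φ hφ
  simp only [mul_sub]
  rw [integral_sub (hφ.integrableOn_deriv_mul hh₁) (hφ.integrableOn_deriv_mul hh₂),
    integral_sub (hφ.integrableOn_mul hF₁) (hφ.integrableOn_mul hF₂), H₁ φ hφ, H₂ φ hφ]
  ring

theorem sum {ι : Type*} {s : Finset ι} {h F : ι → ℝ → ℝ}
    (H : ∀ i ∈ s, HasWeakDeriv a b (h i) (F i)) (hh : ∀ i ∈ s, IntegrableOn (h i) (Icc a b))
    (hF : ∀ i ∈ s, IntegrableOn (F i) (Icc a b)) :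
    HasWeakDeriv a b (fun t => ∑ i ∈ s, h i t) fun t => ∑ i ∈ s, F i t := by
  intro φ hφ
  simp only [Finset.mul_sum]
  rw [integral_finsetSum _ fun i hi => hφ.integrableOn_deriv_mul (hh i hi),
    integral_finsetSum _ fun i hi => hφ.integrableOn_mul (hF i hi), ← Finset.sum_neg_distrib]
  exact Finset.sum_congr rfl fun i hi => H i hi φ hφ

theorem mul_const (H : HasWeakDeriv a b h F) (C : ℝ) :
    HasWeakDeriv a b (fun t => h t * C) fun t => F t * C := by
  intro φ hφ
  simp only [← mul_assoc, integral_mul_const]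
  rw [H φ hφ, neg_mul]

theorem congr_ae {h₁ F₁ : ℝ → ℝ} (H : HasWeakDeriv a b h F)
    (hh : h =ᵐ[volume.restrict (Icc a b)] h₁) (hF : F =ᵐ[volume.restrict (Icc a b)] F₁) :
    HasWeakDeriv a b h₁ F₁ := by
  intro φ hφ
  have hleft : ∫ t in Icc a b, deriv φ t * h t = ∫ t in Icc a b, deriv φ t * h₁ t :=
    integral_congr_ae (Filter.EventuallyEq.rfl.mul hh)
  have hright : ∫ t in Icc a b, φ t * F t = ∫ t in Icc a b, φ t * F₁ t :=
    integral_congr_ae (Filter.EventuallyEq.rfl.mul hF)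
  rw [← hleft, ← hright, H φ hφ]

theorem of_absolutelyContinuousOnInterval (hab : a ≤ b)
    (hh : AbsolutelyContinuousOnInterval h a b) : HasWeakDeriv a b h (deriv h) := by
  intro φ hφ
  have hφac : AbsolutelyContinuousOnInterval φ a b :=
    (hφ.contDiff.of_le (by simp)).contDiffOn.absolutelyContinuousOnInterval
  have hparts := hφac.integral_mul_deriv_eq_deriv_mul hh
  rw [hφ.apply_eq_zero (x := a) (by simp), hφ.apply_eq_zero (x := b) (by simp),
    intervalIntegral.integral_of_le hab, intervalIntegral.integral_of_le hab] at hparts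
  rw [integral_Icc_eq_integral_Ioc, integral_Icc_eq_integral_Ioc, hparts]
  ring

theorem primitive (hab : a ≤ b) (hF : IntervalIntegrable F volume a b) :
    HasWeakDeriv a b (fun x => ∫ y in a..x, F y) F := by
  refine (of_absolutelyContinuousOnInterval hab
    (hF.absolutelyContinuousOnInterval_intervalIntegral left_mem_uIcc)).congr_ae .rfl ?_
  filter_upwards [ae_restrict_of_ae hF.ae_hasDerivAt_integral,
    ae_restrict_mem measurableSet_Icc] with x hderiv hx
  exact (hderiv (Icc_subset_uIcc hx) a left_mem_uIcc).deriv

/-- Du Bois-Reymond: for `ψ` and `ρ` with `∫ ρ = 1`, the function `ψ - (∫ ψ) ρ` is the derivative of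
a test function, hence orthogonal to `h`, so `h` integrates against `ψ` as the constant `∫ ρ h`. -/
theorem eqOn_const (hab : a < b) (hh : ContinuousOn h (Icc a b)) (H : HasWeakDeriv a b h 0) :
    ∃ C, EqOn h (fun _ => C) (Icc a b) := by
  obtain ⟨ρ, hρ, hρ_one⟩ := IsTestFunction.exists_integral_eq_one hab
  have hhi : IntegrableOn h (Icc a b) := hh.integrableOn_Icc
  set C : ℝ := ∫ t in Icc a b, ρ t * h t with hC
  have hmean {ψ : ℝ → ℝ} (hψ : IsTestFunction a b ψ) :
      ∫ t in Icc a b, ψ t * h t = (∫ t, ψ t) * C := by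
    set χ : ℝ → ℝ := fun t => ψ t - (∫ t, ψ t) * ρ t
    have hχ : IsTestFunction a b χ := hψ.sub (hρ.const_mul _)
    have hχ_zero : ∫ t, χ t = 0 := by
      rw [integral_sub (hψ.continuous.integrable_of_hasCompactSupport hψ.hasCompactSupport)
        ((hρ.continuous.integrable_of_hasCompactSupport hρ.hasCompactSupport).const_mul _),
        integral_const_mul, hρ_one, mul_one, sub_self]
    have hχh := H _ (hχ.primitive hχ_zero)
    simp only [hχ.continuous.deriv_integral χ a, χ, Pi.zero_apply, mul_zero, integral_zero,
      neg_zero, sub_mul, mul_assoc] at hχh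
    rwa [integral_sub (hψ.integrableOn_mul hhi) ((hρ.integrableOn_mul hhi).const_mul _),
      integral_const_mul, ← hC, sub_eq_zero] at hχh
  have hae : ∀ᵐ x, x ∈ Ioo a b → h x - C = 0 := by
    refine isOpen_Ioo.ae_eq_zero_of_integral_contDiff_smul_eq_zero
      (((hh.sub continuousOn_const).mono Ioo_subset_Icc_self).locallyIntegrableOn
        measurableSet_Ioo) ?_
    intro ψ hψ hψc hψs
    have hψ : IsTestFunction a b ψ := ⟨hψ, hψc, hψs⟩
    simp only [smul_eq_mul]
    rw [← hψ.setIntegral_mul]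
    simp only [mul_sub]
    rw [integral_sub (hψ.integrableOn_mul hhi)
      (hψ.integrableOn_mul continuousOn_const.integrableOn_Icc), hmean hψ,
      hψ.setIntegral_mul, integral_mul_const, sub_self]
  have heq : EqOn h (fun _ => C) (Ioo a b) := by
    refine Measure.eqOn_open_of_ae_eq (μ := volume) ?_ isOpen_Ioo (hh.mono Ioo_subset_Icc_self)
      continuousOn_const
    filter_upwards [ae_restrict_of_ae hae, ae_restrict_mem measurableSet_Ioo] with x hx hx'
    exact sub_eq_zero.1 (hx hx')
  exact ⟨C, heq.of_subset_closure hh continuousOn_const Ioo_subset_Icc_self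
    (closure_Ioo hab.ne).ge⟩

theorem sub_eq_integral (hab : a < b) (hh : ContinuousOn h (Icc a b))
    (hF : IntegrableOn F (Icc a b)) (H : HasWeakDeriv a b h F) {s t : ℝ} (hs : s ∈ Icc a b)
    (ht : t ∈ Icc a b) : h t - h s = ∫ x in s..t, F x := by
  have hFi : IntervalIntegrable F volume a b :=
    (intervalIntegrable_iff_integrableOn_Icc_of_le hab.le).2 hF
  have hprim : ContinuousOn (fun x => ∫ y in a..x, F y) (Icc a b) := by
    simpa only [uIcc_of_le hab.le] using
      (hFi.absolutelyContinuousOnInterval_intervalIntegral left_mem_uIcc).continuousOn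
  have hzero : HasWeakDeriv a b (fun x => h x - ∫ y in a..x, F y) 0 :=
    (H.sub (.primitive hab.le hFi) hh.integrableOn_Icc hprim.integrableOn_Icc hF hF).congr_ae
      .rfl (.of_forall fun x => sub_self (F x))
  obtain ⟨C, hC⟩ := eqOn_const hab (hh.sub hprim) hzero
  have hinit {x : ℝ} (hx : x ∈ Icc a b) : IntervalIntegrable F volume a x :=
    hFi.mono_set (uIcc_subset_uIcc_left (Icc_subset_uIcc hx))
  rw [← intervalIntegral.integral_interval_sub_left (hinit ht) (hinit hs)]
  have hCs : h s - ∫ y in a..s, F y = C := hC hs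
  have hCt : h t - ∫ y in a..t, F y = C := hC ht
  linarith

end HasWeakDeriv

end WeakDerivative

section EnergyIdentity

open Filter Topology

section Averages

theorem tendsto_inv_mul_integral_increment {E : ℝ → ℝ} (hE : Continuous E) (a b : ℝ) :
    Tendsto (fun h => h⁻¹ * ∫ t in a..b, (E (h + t) - E t)) (𝓝[≠] 0) (𝓝 (E b - E a)) := by
  have hint (u v : ℝ) : IntervalIntegrable E volume u v := hE.intervalIntegrable u v
  have hprim (x : ℝ) : HasDerivAt (fun x => ∫ t in a..x, E t) (E x) x :=
    (hE.integral_hasStrictDerivAt a x).hasDerivAt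
  have hshift (x : ℝ) : HasDerivAt (fun h => ∫ t in a..h + x, E t) (E x) 0 :=
    .comp_add_const (x := 0) x (by simpa only [zero_add] using hprim x)
  refine (((hshift b).sub (hshift a)).tendsto_slope_zero).congr fun h => ?_
  have hcomp : Continuous fun t => E (h + t) := hE.comp (continuous_const_add h)
  rw [intervalIntegral.integral_sub (hcomp.intervalIntegrable _ _) (hint _ _),
    intervalIntegral.integral_comp_add_left E h,
    ← intervalIntegral.integral_interval_sub_left (hint a (h + b)) (hint a (h + a))]
  simp

theorem tendsto_inv_mul_integral_zero {K : ℝ → ℝ → ℝ} (hK : Continuous K.uncurry) :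
    Tendsto (fun h => h⁻¹ * ∫ s in (0 : ℝ)..h, K s h) (𝓝[≠] 0) (𝓝 (K 0 0)) := by
  have hcont : Continuous fun h => ∫ x in (0 : ℝ)..1, K (h * x) h :=
    intervalIntegral.continuous_parametric_intervalIntegral_of_continuous'
      (f := fun h x => K (h * x) h) (by fun_prop) 0 1
  have hlim : Tendsto (fun h => ∫ x in (0 : ℝ)..1, K (h * x) h) (𝓝[≠] 0) (𝓝 (K 0 0)) := by
    simpa using (hcont.tendsto 0).mono_left nhdsWithin_le_nhds
  refine hlim.congr' ?_
  filter_upwards [self_mem_nhdsWithin] with h hh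
  simpa using intervalIntegral.integral_comp_mul_left (a := 0) (b := 1) (fun s => K s h) hh

end Averages

section Translation

variable {X Z : Type*} [NormedAddCommGroup X] [NormedSpace ℝ X] [NormedAddCommGroup Z]

theorem continuous_mk_vadd_Lp (F : Lp Z 2 (volume : Measure ℝ)) :
    Continuous fun s : ℝ => DomAddAct.mk s +ᵥ F :=
  have : Fact ((2 : ENNReal) ≠ ⊤) := ⟨by simp⟩
  DomAddAct.continuous_mk.vadd continuous_const

theorem integrable_apply_of_memLp_two {α : Type*} {_ : MeasurableSpace α} {μ : Measure α}
    {F : α → StrongDual ℝ X} {w : α → X} (hF : MemLp F 2 μ) (hw : MemLp w 2 μ) :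
    Integrable (fun t => F t (w t)) μ :=
  memLp_one_iff_integrable.1 ((ContinuousLinearMap.id ℝ (StrongDual ℝ X)).memLp_of_bilin 1 hF hw)

/-- The duality pairing `(F, w) ↦ ∫_A F(t)(w(t)) dμ` between `L²(X*)` and `L²(X)`, as a continuous
bilinear map. -/
noncomputable def dualPairing {α : Type*} [MeasurableSpace α] (μ : Measure α) (A : Set α) :
    Lp (StrongDual ℝ X) 2 μ →L[ℝ] Lp X 2 μ →L[ℝ] ℝ :=
  ((ContinuousLinearMap.id ℝ (StrongDual ℝ X)).lpPairing (μ.restrict A) 2 2).bilinearComp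
    (LpToLpRestrictCLM α (StrongDual ℝ X) ℝ μ 2 A) (LpToLpRestrictCLM α X ℝ μ 2 A)

theorem dualPairing_apply {α : Type*} [MeasurableSpace α] {μ : Measure α} (A : Set α)
    (F : Lp (StrongDual ℝ X) 2 μ) (w : Lp X 2 μ) :
    dualPairing μ A F w = ∫ t in A, F t (w t) ∂μ := by
  rw [dualPairing, ContinuousLinearMap.bilinearComp_apply,
    ContinuousLinearMap.lpPairing_eq_integral]
  apply integral_congr_ae
  filter_upwards [LpToLpRestrictCLM_coeFn ℝ A F, LpToLpRestrictCLM_coeFn ℝ A w] with t hF hw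
  rw [hF, hw, ContinuousLinearMap.id_apply]

theorem integral_integral_translate (A : Set ℝ) (ν : Measure ℝ) [IsFiniteMeasure ν]
    (F : Lp (StrongDual ℝ X) 2 (volume : Measure ℝ)) (w : Lp X 2 (volume : Measure ℝ)) :
    ∫ t in A, ∫ s, F (s + t) (w t) ∂ν = ∫ s, dualPairing volume A (DomAddAct.mk s +ᵥ F) w ∂ν := by
  have hF : MemLp (fun z : ℝ × ℝ => F (z.1 + z.2)) 2 (ν.prod volume) :=
    ((Lp.memLp F).comp_snd ν).comp_measurePreserving (measurePreserving_prod_add ν volume)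
  have hw : MemLp (fun z : ℝ × ℝ => w z.2) 2 (ν.prod volume) := (Lp.memLp w).comp_snd ν
  have hint : Integrable (fun z : ℝ × ℝ => F (z.1 + z.2) (w z.2)) (ν.prod volume) :=
    integrable_apply_of_memLp_two hF hw
  rw [← integral_integral_swap
    (hint.mono_measure (Measure.prod_mono le_rfl Measure.restrict_le_self))]
  congr 1 with s
  rw [dualPairing_apply]
  apply integral_congr_ae
  filter_upwards [ae_restrict_of_ae (DomAddAct.vadd_Lp_ae_eq (DomAddAct.mk s) F)] with t ht
  rw [ht]
  rfl

end Translation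

variable {X Y : Type*} [NormedAddCommGroup X] [NormedSpace ℝ X] [NormedAddCommGroup Y]
  [NormedSpace ℝ Y] {a b : ℝ} {B : Y →L[ℝ] Y →L[ℝ] ℝ} {j : X →L[ℝ] Y} {y : ℝ → Y}

/-- By symmetry, `B(y(t+h), y(t+h)) - B(y(t), y(t)) = B(y(t+h) - y(t), y(t+h) + y(t))`, where the
second argument is the value of a test function for almost every `t`. -/
theorem integral_energy_increment {β h : ℝ} (haβ : a ≤ β) (hh : 0 < h) (hβ : β + h ≤ b)
    (hB : ∀ x x', B x x' = B x' x) {w : Lp X 2 (volume : Measure ℝ)}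
    {F : Lp (StrongDual ℝ X) 2 (volume : Measure ℝ)}
    (hyw : ∀ᵐ t, t ∈ Icc a b → y t = j (w t))
    (hincr : ∀ v, ∀ s ∈ Icc a b, ∀ t ∈ Icc a b,
      B (y t) (j v) - B (y s) (j v) = ∫ x in s..t, F x v) :
    ∫ t in a..β, (B (y (h + t)) (y (h + t)) - B (y t) (y t))
      = ∫ s in (0 : ℝ)..h,
        dualPairing volume (Ioc a β) (DomAddAct.mk s +ᵥ F) (w + (DomAddAct.mk h +ᵥ w)) := by
  rw [intervalIntegral.integral_of_le haβ, intervalIntegral.integral_of_le hh.le,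
    ← integral_integral_translate]
  apply integral_congr_ae
  have hyw_shift : ∀ᵐ t, h + t ∈ Icc a b → y (h + t) = j (w (h + t)) :=
    (measurePreserving_add_left volume h).quasiMeasurePreserving.ae hyw
  filter_upwards [ae_restrict_of_ae hyw, ae_restrict_of_ae hyw_shift,
    ae_restrict_of_ae (DomAddAct.vadd_Lp_ae_eq (DomAddAct.mk h) w),
    ae_restrict_of_ae (Lp.coeFn_add w (DomAddAct.mk h +ᵥ w)),
    ae_restrict_mem measurableSet_Ioc] with t hyt hyht hwh hsum ht
  have htmem : t ∈ Icc a b := ⟨ht.1.le, by linarith [ht.2]⟩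
  have hhtmem : h + t ∈ Icc a b := ⟨by linarith [ht.1], by linarith [ht.2]⟩
  generalize (w + (DomAddAct.mk h +ᵥ w) : Lp X 2 volume) t = v at hsum
  have hv : j v = y t + y (h + t) := by
    rw [hsum, Pi.add_apply, hwh, map_add, hyt htmem, hyht hhtmem]
    rfl
  have hFv : ∫ s in (0 : ℝ)..h, F (s + t) v = B (y (h + t)) (j v) - B (y t) (j v) := by
    rw [hincr v t htmem (h + t) hhtmem,
      intervalIntegral.integral_comp_add_right (fun x => F x v) t, zero_add]
  rw [← intervalIntegral.integral_of_le hh.le, hFv, hv, map_add, map_add, hB (y (h + t)) (y t)]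
  ring

theorem energy_sub_eq_two_mul_dualPairing {β : ℝ} (haβ : a ≤ β) (hβ : β < b)
    (hB : ∀ x x', B x x' = B x' x) {w : Lp X 2 (volume : Measure ℝ)}
    {F : Lp (StrongDual ℝ X) 2 (volume : Measure ℝ)} (hy : ContinuousOn y (Icc a b))
    (hyw : ∀ᵐ t, t ∈ Icc a b → y t = j (w t))
    (hincr : ∀ v, ∀ s ∈ Icc a b, ∀ t ∈ Icc a b,
      B (y t) (j v) - B (y s) (j v) = ∫ x in s..t, F x v) :
    B (y β) (y β) - B (y a) (y a) = 2 * dualPairing volume (Ioc a β) F w := by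
  have hab : a ≤ b := haβ.trans hβ.le
  set E : ℝ → ℝ := IccExtend hab fun t => B (y t) (y t)
  have hE_cont : Continuous E :=
    (continuousOn_iff_continuous_domRestrict.1
      ((B.continuous.comp_continuousOn hy).clm_apply hy)).Icc_extend'
  have hE_eq {t : ℝ} (ht : t ∈ Icc a b) : E t = B (y t) (y t) :=
    IccExtend_of_mem hab (fun t : Icc a b => B (y t) (y t)) ht
  set K : ℝ → ℝ → ℝ := fun s h =>
    dualPairing volume (Ioc a β) (DomAddAct.mk s +ᵥ F) (w + (DomAddAct.mk h +ᵥ w)) with hK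
  have hK_cont : Continuous K.uncurry := by
    have hleft := (continuous_mk_vadd_Lp F).comp (continuous_fst (X := ℝ) (Y := ℝ))
    have hright := (continuous_mk_vadd_Lp w).comp (continuous_snd (X := ℝ) (Y := ℝ))
    exact ((dualPairing volume (Ioc a β)).continuous.comp hleft).clm_apply
      (hright.const_add w)
  have hlim := (tendsto_inv_mul_integral_increment hE_cont a β).mono_left
    (nhdsGT_le_nhdsNE 0)
  have hlim' := (tendsto_inv_mul_integral_zero hK_cont).mono_left (nhdsGT_le_nhdsNE 0)
  have heq : (fun h => h⁻¹ * ∫ t in a..β, (E (h + t) - E t))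
      =ᶠ[𝓝[>] 0] fun h => h⁻¹ * ∫ s in (0 : ℝ)..h, K s h := by
    filter_upwards [Ioc_mem_nhdsGT (sub_pos.2 hβ)] with h hh
    rw [← integral_energy_increment haβ hh.1 (by linarith [hh.2]) hB hyw hincr]
    congr 1
    refine intervalIntegral.integral_congr fun t ht => ?_
    rw [uIcc_of_le haβ] at ht
    rw [hE_eq ⟨ht.1, ht.2.trans hβ.le⟩,
      hE_eq ⟨by linarith [ht.1, hh.1], by linarith [ht.2, hh.2]⟩]
  rw [← hE_eq ⟨haβ, hβ.le⟩, ← hE_eq ⟨le_rfl, hab⟩,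
    tendsto_nhds_unique hlim (hlim'.congr' heq.symm)]
  simp only [hK, DomAddAct.mk_zero, zero_vadd, map_add]
  ring

theorem exists_Lp_eq_on {α Z : Type*} [MeasurableSpace α] [NormedAddCommGroup Z] {μ : Measure α}
    {p : ENNReal} {s : Set α} (hs : MeasurableSet s) {f : α → Z} (hf : MemLp f p (μ.restrict s)) :
    ∃ f' : Lp Z p μ, ∀ᵐ t ∂μ, t ∈ s → f' t = f t := by
  have hf' : MemLp (s.indicator f) p μ := (memLp_indicator_iff_restrict hs).2 hf
  refine ⟨hf'.toLp, ?_⟩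
  filter_upwards [hf'.coeFn_toLp] with t h ht
  rw [h, indicator_of_mem ht]

theorem energy_sub_eq_two_mul_integral {β : ℝ} (haβ : a ≤ β) (hβ : β < b)
    (hB : ∀ x x', B x x' = B x' x) {w : ℝ → X} (hw : MemLp w 2 (volume.restrict (Icc a b)))
    {F : ℝ → StrongDual ℝ X} (hF : MemLp F 2 (volume.restrict (Icc a b)))
    (hy : ContinuousOn y (Icc a b)) (hyw : ∀ᵐ t ∂volume.restrict (Icc a b), y t = j (w t))
    (hderiv : ∀ v, HasWeakDeriv a b (fun t => B (y t) (j v)) fun t => F t v) :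
    B (y β) (y β) - B (y a) (y a) = 2 * ∫ t in a..β, F t (w t) := by
  obtain ⟨w', hw'⟩ := exists_Lp_eq_on measurableSet_Icc hw
  obtain ⟨F', hF'⟩ := exists_Lp_eq_on measurableSet_Icc hF
  have hyw' : ∀ᵐ t, t ∈ Icc a b → y t = j (w' t) := by
    filter_upwards [(ae_restrict_iff' measurableSet_Icc).1 hyw, hw'] with t h1 h2 ht
    rw [h1 ht, h2 ht]
  have hincr : ∀ v, ∀ s ∈ Icc a b, ∀ t ∈ Icc a b,
      B (y t) (j v) - B (y s) (j v) = ∫ x in s..t, F' x v := by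
    intro v s hs t ht
    have hFv : IntegrableOn (fun t => F t v) (Icc a b) :=
      (ContinuousLinearMap.apply ℝ ℝ v).integrable_comp (hF.integrable (by norm_num))
    have hyv : ContinuousOn (fun t => B (y t) (j v)) (Icc a b) :=
      (B.continuous.comp_continuousOn hy).clm_apply continuousOn_const
    rw [(hderiv v).sub_eq_integral (haβ.trans_lt hβ) hyv hFv hs ht]
    refine intervalIntegral.integral_congr_ae ?_
    filter_upwards [hF'] with x hx hxst
    rw [hx (uIcc_subset_Icc hs ht (uIoc_subset_uIcc hxst))]
  rw [energy_sub_eq_two_mul_dualPairing haβ hβ hB hy hyw' hincr, dualPairing_apply,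
    ← intervalIntegral.integral_of_le haβ]
  congr 1
  refine intervalIntegral.integral_congr_ae ?_
  filter_upwards [hw', hF'] with t h1 h2 ht
  rw [uIoc_of_le haβ] at ht
  have htmem : t ∈ Icc a b := ⟨ht.1.le, ht.2.trans hβ.le⟩
  rw [h1 htmem, h2 htmem]

theorem energy_identity (hab : a < b) (hB : ∀ x x', B x x' = B x' x) {w : ℝ → X}
    (hw : MemLp w 2 (volume.restrict (Icc a b))) {F : ℝ → StrongDual ℝ X}
    (hF : MemLp F 2 (volume.restrict (Icc a b))) (hy : ContinuousOn y (Icc a b))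
    (hyw : ∀ᵐ t ∂volume.restrict (Icc a b), y t = j (w t))
    (hderiv : ∀ v, HasWeakDeriv a b (fun t => B (y t) (j v)) fun t => F t v) :
    B (y b) (y b) - B (y a) (y a) = 2 * ∫ t in Icc a b, F t (w t) := by
  have hint : IntervalIntegrable (fun t => F t (w t)) volume a b :=
    (intervalIntegrable_iff_integrableOn_Icc_of_le hab.le).2
      (integrable_apply_of_memLp_two hF hw)
  have henergy : ContinuousOn (fun t => B (y t) (y t) - B (y a) (y a)) (Icc a b) :=
    ((B.continuous.comp_continuousOn hy).clm_apply hy).sub continuousOn_const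
  have hprim : ContinuousOn (fun t => 2 * ∫ s in a..t, F s (w s)) (Icc a b) := by
    simpa only [uIcc_of_le hab.le] using
      (hint.absolutelyContinuousOnInterval_intervalIntegral left_mem_uIcc).continuousOn.const_mul 2
  have hbefore : EqOn (fun t => B (y t) (y t) - B (y a) (y a))
      (fun t => 2 * ∫ s in a..t, F s (w s)) (Ico a b) := fun t ht =>
    energy_sub_eq_two_mul_integral ht.1 ht.2 hB hw hF hy hyw hderiv
  have hend : B (y b) (y b) - B (y a) (y a) = 2 * ∫ s in a..b, F s (w s) :=
    hbefore.of_subset_closure henergy hprim Ico_subset_Icc_self (closure_Ico hab.ne).ge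
      (right_mem_Icc.2 hab.le)
  rw [hend, intervalIntegral.integral_of_le hab.le, integral_Icc_eq_integral_Ioc]

end EnergyIdentity

section Hypercircle

variable {E : Type*} [NormedAddCommGroup E] [InnerProductSpace ℝ E] {M N : E →L[ℝ] E}

theorem inner_residual_self (hN : ∀ x y, ⟪N x, y⟫ = ⟪x, N y⟫) (hNM : Function.LeftInverse N M)
    (u v σ : E) :
    ⟪N (σ - M v), σ - M v⟫
      = ⟪N (M u - σ), M u - σ⟫ + ⟪M (u - v), u - v⟫ - 2 * ⟪M u - σ, u - v⟫ := by
  have hdecomp : σ - M v = M (u - v) - (M u - σ) := by rw [map_sub]; abel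
  rw [hdecomp]
  generalize M u - σ = a, u - v = b
  rw [map_sub, hNM, inner_sub_left, inner_sub_right, inner_sub_right, hN a (M b), hNM,
    real_inner_comm (M b), real_inner_comm a b]
  ring

theorem inner_averaged_residual_self (hN : ∀ x y, ⟪N x, y⟫ = ⟪x, N y⟫)
    (hNM : Function.LeftInverse N M) (u v σ : E) :
    4 * ⟪N (M u - (1 / 2 : ℝ) • (σ + M v)), M u - (1 / 2 : ℝ) • (σ + M v)⟫
      = ⟪N (σ - M v), σ - M v⟫ + 4 * ⟪M u - σ, u - v⟫ := by
  have hdecomp :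
      M u - (1 / 2 : ℝ) • (σ + M v) = (1 / 2 : ℝ) • (M u - σ) + (1 / 2 : ℝ) • M (u - v) := by
    rw [map_sub]; module
  rw [inner_residual_self hN hNM u v σ, hdecomp, ← smul_add]
  generalize M u - σ = a, u - v = b
  rw [map_smul, real_inner_smul_left, real_inner_smul_right, map_add, hNM, inner_add_left,
    inner_add_right, inner_add_right, hN a (M b), hNM, real_inner_comm (M b), real_inner_comm a b]
  ring

variable {α : Type*} {mα : MeasurableSpace α} {ν : Measure α} {u v σ : α → E}

theorem integrable_inner_of_memLp_two (hu : MemLp u 2 ν) (hv : MemLp v 2 ν) :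
    Integrable (fun t => ⟪u t, v t⟫) ν :=
  memLp_one_iff_integrable.1 ((innerSL ℝ).memLp_of_bilin 1 hu hv)

theorem integrable_inner_map_self (L : E →L[ℝ] E) (hu : MemLp u 2 ν) :
    Integrable (fun t => ⟪L (u t), u t⟫) ν :=
  integrable_inner_of_memLp_two (L.comp_memLp' hu) hu

theorem integral_inner_residual (hN : ∀ x y, ⟪N x, y⟫ = ⟪x, N y⟫)
    (hNM : Function.LeftInverse N M) (hu : MemLp u 2 ν) (hv : MemLp v 2 ν) (hσ : MemLp σ 2 ν) :
    ∫ t, ⟪N (σ t - M (v t)), σ t - M (v t)⟫ ∂ν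
      = ∫ t, ⟪N (M (u t) - σ t), M (u t) - σ t⟫ ∂ν + ∫ t, ⟪M (u t - v t), u t - v t⟫ ∂ν
        - 2 * ∫ t, ⟪M (u t) - σ t, u t - v t⟫ ∂ν := by
  have hres : MemLp (fun t => M (u t) - σ t) 2 ν := (M.comp_memLp' hu).sub hσ
  have herr : MemLp (fun t => u t - v t) 2 ν := hu.sub hv
  have hint₁ := integrable_inner_map_self N hres
  have hint₂ := integrable_inner_map_self M herr
  rw [← integral_const_mul, ← integral_add hint₁ hint₂,
    ← integral_sub (hint₁.fun_add hint₂) ((integrable_inner_of_memLp_two hres herr).const_mul 2)]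
  exact integral_congr_ae (.of_forall fun t => inner_residual_self hN hNM (u t) (v t) (σ t))

theorem integral_inner_averaged_residual (hN : ∀ x y, ⟪N x, y⟫ = ⟪x, N y⟫)
    (hNM : Function.LeftInverse N M) (hu : MemLp u 2 ν) (hv : MemLp v 2 ν) (hσ : MemLp σ 2 ν) :
    4 * ∫ t, ⟪N (M (u t) - (1 / 2 : ℝ) • (σ t + M (v t))),
        M (u t) - (1 / 2 : ℝ) • (σ t + M (v t))⟫ ∂ν
      = ∫ t, ⟪N (σ t - M (v t)), σ t - M (v t)⟫ ∂ν
        + 4 * ∫ t, ⟪M (u t) - σ t, u t - v t⟫ ∂ν := by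
  have hgap : MemLp (fun t => σ t - M (v t)) 2 ν := hσ.sub (M.comp_memLp' hv)
  have hres : MemLp (fun t => M (u t) - σ t) 2 ν := (M.comp_memLp' hu).sub hσ
  have herr : MemLp (fun t => u t - v t) 2 ν := hu.sub hv
  rw [← integral_const_mul, ← integral_const_mul,
    ← integral_add (integrable_inner_map_self N hgap)
      ((integrable_inner_of_memLp_two hres herr).const_mul 4)]
  exact integral_congr_ae
    (.of_forall fun t => inner_averaged_residual_self hN hNM (u t) (v t) (σ t))

end Hypercircle

section Multiplication

variable {α : Type*} {mα : MeasurableSpace α} {μ : Measure α} {w : α → ℝ}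

section Normed

variable {G : Type*} [NormedAddCommGroup G] [NormedSpace ℝ G] {p : ENNReal} [Fact (1 ≤ p)]

/-- Multiplication by an essentially bounded weight, as a continuous linear endomorphism of
`Lᵖ`. -/
noncomputable def mulLp (hw : MemLp w ⊤ μ) : Lp G p μ →L[ℝ] Lp G p μ :=
  (ContinuousLinearMap.lsmul ℝ ℝ : ℝ →L[ℝ] G →L[ℝ] G).holderL μ ⊤ p p (hw.toLp w)

theorem coeFn_mulLp (hw : MemLp w ⊤ μ) (A : Lp G p μ) :
    mulLp hw A =ᵐ[μ] fun x => w x • A x := by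
  filter_upwards [(ContinuousLinearMap.lsmul ℝ ℝ : ℝ →L[ℝ] G →L[ℝ] G).coeFn_holder (r := p)
    (hw.toLp w) A, hw.coeFn_toLp] with x hholder hx
  rw [mulLp, ContinuousLinearMap.holderL_apply_apply, hholder, hx]
  rfl

theorem mulLp_leftInverse {w' : α → ℝ} (hw : MemLp w ⊤ μ) (hw' : MemLp w' ⊤ μ)
    (hww' : ∀ᵐ x ∂μ, w' x * w x = 1) :
    Function.LeftInverse (mulLp hw') (mulLp hw : Lp G p μ → Lp G p μ) := by
  intro A
  apply Lp.ext
  filter_upwards [coeFn_mulLp hw' (mulLp hw A), coeFn_mulLp hw A, hww'] with x hx' hx hone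
  rw [hx', hx, smul_smul, hone, one_smul]

theorem coeFn_mulLp_sub (hw : MemLp w ⊤ μ) (A B : Lp G p μ) :
    ⇑(mulLp hw A - B) =ᵐ[μ] fun x => w x • A x - B x := by
  filter_upwards [Lp.coeFn_sub (mulLp hw A) B, coeFn_mulLp hw A] with x hsub hx
  rw [hsub, Pi.sub_apply, hx]

theorem coeFn_sub_mulLp (hw : MemLp w ⊤ μ) (A B : Lp G p μ) :
    ⇑(B - mulLp hw A) =ᵐ[μ] fun x => B x - w x • A x := by
  filter_upwards [Lp.coeFn_sub B (mulLp hw A), coeFn_mulLp hw A] with x hsub hx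
  rw [hsub, Pi.sub_apply, hx]

theorem coeFn_mulLp_sub_average (hw : MemLp w ⊤ μ) (A A' B : Lp G p μ) :
    ⇑(mulLp hw A - (1 / 2 : ℝ) • (B + mulLp hw A'))
      =ᵐ[μ] fun x => w x • A x - (1 / 2 : ℝ) • (B x + w x • A' x) := by
  filter_upwards [coeFn_mulLp_sub hw A ((1 / 2 : ℝ) • (B + mulLp hw A')),
    Lp.coeFn_smul (1 / 2 : ℝ) (B + mulLp hw A'), Lp.coeFn_add B (mulLp hw A'),
    coeFn_mulLp hw A'] with x hsub hsmul hadd hx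
  rw [hsub, hsmul, Pi.smul_apply, hadd, Pi.add_apply, hx]

end Normed

variable {G : Type*} [NormedAddCommGroup G] [InnerProductSpace ℝ G]

theorem inner_mulLp (hw : MemLp w ⊤ μ) (A B : Lp G 2 μ) :
    ⟪mulLp hw A, B⟫ = ∫ x, w x * ⟪A x, B x⟫ ∂μ := by
  rw [L2.inner_def]
  refine integral_congr_ae ?_
  filter_upwards [coeFn_mulLp hw A] with x hx
  rw [hx, real_inner_smul_left]

theorem inner_mulLp_comm (hw : MemLp w ⊤ μ) (A B : Lp G 2 μ) :
    ⟪mulLp hw A, B⟫ = ⟪A, mulLp hw B⟫ := by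
  rw [real_inner_comm _ A, inner_mulLp, inner_mulLp]
  simp only [real_inner_comm]

end Multiplication

section ConstitutiveLaw

variable {d : ℕ} {Ω Γu : Set (Space d)} {k r w : Space d → ℝ} {T : ℝ}

theorem IsPositiveCoefficient.ae_pos (hw : IsPositiveCoefficient Ω w) :
    ∀ᵐ x ∂volume.restrict Ω, 0 < w x := by
  obtain ⟨-, α, β, hα, hbounds⟩ := hw
  filter_upwards [hbounds] with x hx using hα.trans_le hx.1

theorem IsPositiveCoefficient.memLp_top (hw : IsPositiveCoefficient Ω w) :
    MemLp w ⊤ (volume.restrict Ω) := by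
  obtain ⟨hmeas, α, β, hα, hbounds⟩ := hw
  refine memLp_top_of_bound hmeas.aestronglyMeasurable β ?_
  filter_upwards [hbounds] with x hx
  exact (Real.norm_of_nonneg (hα.le.trans hx.1)).trans_le hx.2

theorem IsPositiveCoefficient.one_div (hw : IsPositiveCoefficient Ω w) :
    IsPositiveCoefficient Ω (fun x => 1 / w x) := by
  obtain ⟨hmeas, α, β, hα, hbounds⟩ := hw
  -- `max` keeps the lower bound positive when `Ω` is null and `β` is arbitrary.
  refine ⟨aemeasurable_const.div hmeas, 1 / max α β, 1 / α, by positivity, ?_⟩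
  filter_upwards [hbounds] with x ⟨hαx, hxβ⟩
  have hx : 0 < w x := hα.trans_le hαx
  exact ⟨one_div_le_one_div_of_le hx (hxβ.trans (le_max_right α β)),
    one_div_le_one_div_of_le hα hαx⟩

theorem IsPositiveCoefficient.normSq_eq_inner {G : Type*} [NormedAddCommGroup G]
    [InnerProductSpace ℝ G] (hw : IsPositiveCoefficient Ω w)
    (A : Lp G 2 (volume.restrict Ω)) : normSq Ω w A = ⟪mulLp hw.memLp_top A, A⟫ := by
  simp only [inner_mulLp, real_inner_self_eq_norm_sq, normSq]

theorem normSq_nonneg {G : Type*} [NormedAddCommGroup G] (hw : IsPositiveCoefficient Ω w)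
    (F : Space d → G) : 0 ≤ normSq Ω w F := by
  refine integral_nonneg_of_ae ?_
  filter_upwards [hw.ae_pos] with x hx
  exact mul_nonneg hx.le (sq_nonneg _)

theorem triNormSq_nonneg {G : Type*} [NormedAddCommGroup G] (hw : IsPositiveCoefficient Ω w)
    (F : ℝ → Space d → G) : 0 ≤ triNormSq Ω T w F :=
  integral_nonneg fun t => normSq_nonneg hw (F t)

theorem triNormSq_congr {G : Type*} [NormedAddCommGroup G] {F F' : ℝ → Space d → G}
    (h : ∀ t, F t =ᵐ[volume.restrict Ω] F' t) : triNormSq Ω T w F = triNormSq Ω T w F' := by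
  refine integral_congr_ae (.of_forall fun t => integral_congr_ae ?_)
  filter_upwards [h t] with x hx
  rw [hx]

/-- The constitutive law `(v, τ) ↦ (r v, k τ)`. It maps the pair `(u, ∇u)` to `(z, q)`; its inverse
is the constitutive law of the coefficients `1 / k` and `1 / r`. -/
noncomputable def constitutiveLaw (hk : IsPositiveCoefficient Ω k)
    (hr : IsPositiveCoefficient Ω r) : FieldPair Ω →L[ℝ] FieldPair Ω :=
  let e := WithLp.prodContinuousLinearEquiv 2 ℝ (ScalarL2 Ω) (VectorL2 Ω)
  e.symm.toContinuousLinearMap ∘L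
    (mulLp hr.memLp_top).prodMap (mulLp hk.memLp_top) ∘L e.toContinuousLinearMap

theorem constitutiveLaw_apply (hk : IsPositiveCoefficient Ω k) (hr : IsPositiveCoefficient Ω r)
    (x : FieldPair Ω) :
    constitutiveLaw hk hr x = WithLp.toLp 2 (mulLp hr.memLp_top x.fst, mulLp hk.memLp_top x.snd) :=
  rfl

theorem inner_constitutiveLaw_comm (hk : IsPositiveCoefficient Ω k)
    (hr : IsPositiveCoefficient Ω r) (x y : FieldPair Ω) :
    ⟪constitutiveLaw hk hr x, y⟫ = ⟪x, constitutiveLaw hk hr y⟫ :=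
  congrArg₂ (· + ·) (inner_mulLp_comm hr.memLp_top x.fst y.fst)
    (inner_mulLp_comm hk.memLp_top x.snd y.snd)

theorem constitutiveLaw_one_div_leftInverse (hk : IsPositiveCoefficient Ω k)
    (hr : IsPositiveCoefficient Ω r) :
    Function.LeftInverse (constitutiveLaw hk.one_div hr.one_div) (constitutiveLaw hk hr) := by
  have hinv : ∀ {w : Space d → ℝ}, IsPositiveCoefficient Ω w →
      ∀ᵐ x ∂volume.restrict Ω, 1 / w x * w x = 1 := fun hw => by
    filter_upwards [hw.ae_pos] with x hx using one_div_mul_cancel hx.ne'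
  intro x
  exact congrArg (WithLp.toLp 2) (Prod.ext
    (mulLp_leftInverse hr.memLp_top hr.one_div.memLp_top (hinv hr) x.fst)
    (mulLp_leftInverse hk.memLp_top hk.one_div.memLp_top (hinv hk) x.snd))

theorem inner_constitutiveLaw_self (hk : IsPositiveCoefficient Ω k)
    (hr : IsPositiveCoefficient Ω r) (x : FieldPair Ω) :
    ⟪constitutiveLaw hk hr x, x⟫ = normSq Ω r x.fst + normSq Ω k x.snd := by
  rw [hr.normSq_eq_inner, hk.normSq_eq_inner]
  rfl

theorem integral_inner_constitutiveLaw_self (hk : IsPositiveCoefficient Ω k)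
    (hr : IsPositiveCoefficient Ω r) {x : ℝ → FieldPair Ω} (hx : MemLp x 2 (timeMeasure T)) :
    ∫ t, ⟪constitutiveLaw hk hr (x t), x t⟫ ∂timeMeasure T
      = triNormSq Ω T k (fun t => (x t).snd) + triNormSq Ω T r (fun t => (x t).fst) := by
  have hfst : Integrable (fun t => normSq Ω r (x t).fst) (timeMeasure T) := by
    simp only [hr.normSq_eq_inner]
    exact integrable_inner_map_self _ hx.prodLp_fst
  have hsnd : Integrable (fun t => normSq Ω k (x t).snd) (timeMeasure T) := by
    simp only [hk.normSq_eq_inner]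
    exact integrable_inner_map_self _ hx.prodLp_snd
  simp only [inner_constitutiveLaw_self]
  rw [integral_add hfst hsnd, add_comm]
  rfl

theorem inner_eq_integral_inner_add_mul (x y : FieldPair Ω) :
    ⟪x, y⟫ = ∫ ξ in Ω, (⟪x.snd ξ, y.snd ξ⟫ + x.fst ξ * y.fst ξ) := by
  have hfst : ⟪x.fst, y.fst⟫ = ∫ ξ in Ω, x.fst ξ * y.fst ξ := by
    simp only [L2.inner_def, RCLike.inner_apply, conj_trivial, mul_comm]
  have hfst_int : Integrable (fun ξ => x.fst ξ * y.fst ξ) (volume.restrict Ω) :=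
    (Lp.memLp x.fst).integrable_mul (Lp.memLp y.fst)
  rw [WithLp.prod_inner_apply, add_comm, integral_add (L2.integrable_inner x.snd y.snd) hfst_int,
    ← hfst]
  rfl

theorem inner_constitutiveLaw (hk : IsPositiveCoefficient Ω k) (hr : IsPositiveCoefficient Ω r)
    (x y : FieldPair Ω) :
    ⟪constitutiveLaw hk hr x, y⟫
      = ∫ ξ in Ω, (k ξ * ⟪x.snd ξ, y.snd ξ⟫ + r ξ * x.fst ξ * y.fst ξ) := by
  rw [inner_eq_integral_inner_add_mul]
  refine integral_congr_ae ?_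
  filter_upwards [coeFn_mulLp hk.memLp_top x.snd, coeFn_mulLp hr.memLp_top x.fst] with ξ hsnd hfst
  simp only [constitutiveLaw_apply, WithLp.toLp_fst, WithLp.toLp_snd, hsnd, hfst,
    real_inner_smul_left, smul_eq_mul]

theorem creSq_eq_integral_inner (hk : IsPositiveCoefficient Ω k) (hr : IsPositiveCoefficient Ω r)
    (û : ℝ → V Ω Γu) (q : ℝ → VectorL2 Ω) (z : ℝ → ScalarL2 Ω) :
    creSq T k r û (fun t => q t) (fun t => z t)
      = ∫ t, ⟪constitutiveLaw hk.one_div hr.one_div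
            (WithLp.toLp 2 (z t, q t) - constitutiveLaw hk hr (û t)),
          WithLp.toLp 2 (z t, q t) - constitutiveLaw hk hr (û t)⟫ ∂timeMeasure T := by
  refine integral_congr_ae (.of_forall fun t => ?_)
  simp only [inner_constitutiveLaw]
  refine integral_congr_ae ?_
  filter_upwards [coeFn_sub_mulLp hk.memLp_top (grad (û t)) (q t),
    coeFn_sub_mulLp hr.memLp_top (fn (û t)) (z t)] with ξ hflux hreaction
  simp only [constitutiveLaw_apply, WithLp.sub_fst, WithLp.sub_snd, real_inner_self_eq_norm_sq]
  rw [mul_assoc, ← sq]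
  exact congrArg₂ (fun (a : Space d) (b : ℝ) => 1 / k ξ * ‖a‖ ^ 2 + 1 / r ξ * b ^ 2)
    hflux.symm hreaction.symm

end ConstitutiveLaw

section Parabolic

variable {d : ℕ} {Ω Γu Γq : Set (Space d)} {T : ℝ} {c k r : Space d → ℝ}

/-- The map `v ↦ fn v` from `𝒱` to `L²(Ω)`, as a continuous linear map. -/
noncomputable def fnL (Ω Γu : Set (Space d)) : V Ω Γu →L[ℝ] ScalarL2 Ω :=
  WithLp.fstL 2 ℝ _ _ ∘L (V Ω Γu).subtypeL

@[simp]
theorem fnL_apply (v : V Ω Γu) : fnL Ω Γu v = fn v :=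
  rfl

/-- The bilinear form `(A, A') ↦ ∫_Ω c A A'` on `L²(Ω)`; the term `c ∂u/∂t` is the weak time
derivative of the functional `v ↦ massForm (u(t), v)`. -/
noncomputable def massForm (hc : IsPositiveCoefficient Ω c) :
    ScalarL2 Ω →L[ℝ] ScalarL2 Ω →L[ℝ] ℝ :=
  innerSL ℝ ∘L mulLp hc.memLp_top

theorem massForm_apply (hc : IsPositiveCoefficient Ω c) (A A' : ScalarL2 Ω) :
    massForm hc A A' = ∫ x in Ω, c x * A x * A' x := by
  refine (inner_mulLp hc.memLp_top A A').trans (integral_congr_ae (.of_forall fun x => ?_))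
  simp only [RCLike.inner_apply, conj_trivial]
  ring

theorem massForm_self (hc : IsPositiveCoefficient Ω c) (A : ScalarL2 Ω) :
    massForm hc A A = normSq Ω c A :=
  (hc.normSq_eq_inner A).symm

theorem massForm_comm (hc : IsPositiveCoefficient Ω c) (A A' : ScalarL2 Ω) :
    massForm hc A A' = massForm hc A' A :=
  (inner_mulLp_comm hc.memLp_top A A').trans (real_inner_comm _ _)

theorem ParabolicSpace.hasWeakDeriv_massForm (hc : IsPositiveCoefficient Ω c)
    (u : ParabolicSpace Ω Γu T c) (v : V Ω Γu) :
    HasWeakDeriv 0 T (fun t => massForm hc (u.rep t) (fnL Ω Γu v)) fun t => u.cdt t v := by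
  have hweak : HasWeakDeriv 0 T (fun t => massForm hc (fn (u.toFun t)) (fn v))
      fun t => u.cdt t v := by
    intro φ hφ
    simp only [massForm_apply]
    exact u.weak_derivative φ hφ.contDiff hφ.hasCompactSupport hφ.tsupport_subset v
  refine hweak.congr_ae ?_ .rfl
  filter_upwards [u.rep_ae_eq] with t ht
  rw [ht, fnL_apply]

theorem normSq_rep_sub_rep (hT : 0 < T) (hc : IsPositiveCoefficient Ω c)
    {u û : ParabolicSpace Ω Γu T c} (h0 : u.rep 0 = û.rep 0) :
    normSq Ω c (u.rep T - û.rep T)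
      = 2 * ∫ t, (u.cdt t - û.cdt t) (u.toFun t - û.toFun t) ∂timeMeasure T := by
  have hmass {w : ParabolicSpace Ω Γu T c} (v : V Ω Γu) :
      IntegrableOn (fun t => massForm hc (w.rep t) (fnL Ω Γu v)) (Icc 0 T) :=
    (((massForm hc).continuous.comp_continuousOn w.continuousOn_rep).clm_apply
      continuousOn_const).integrableOn_Icc
  have hcdt {w : ParabolicSpace Ω Γu T c} (v : V Ω Γu) :
      IntegrableOn (fun t => w.cdt t v) (Icc 0 T) :=
    integrable_apply_of_memLp_two w.memLp_cdt (memLp_const v)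
  have hderiv (v : V Ω Γu) : HasWeakDeriv 0 T
      (fun t => massForm hc (u.rep t - û.rep t) (fnL Ω Γu v)) fun t => (u.cdt t - û.cdt t) v := by
    simpa only [map_sub, sub_apply] using
      (u.hasWeakDeriv_massForm hc v).sub (û.hasWeakDeriv_massForm hc v) (hmass v) (hmass v)
        (hcdt v) (hcdt v)
  have hrep : ∀ᵐ t ∂timeMeasure T, u.rep t - û.rep t = fnL Ω Γu (u.toFun t - û.toFun t) := by
    filter_upwards [u.rep_ae_eq, û.rep_ae_eq] with t ht ht'
    rw [ht, ht', map_sub, fnL_apply, fnL_apply]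
  have herr : MemLp (fun t => u.toFun t - û.toFun t) 2 (timeMeasure T) :=
    u.memLp_toFun.sub û.memLp_toFun
  have hcdt_err : MemLp (fun t => u.cdt t - û.cdt t) 2 (timeMeasure T) :=
    MemLp.sub (f := u.cdt) (g := û.cdt) u.memLp_cdt û.memLp_cdt
  have hcont : ContinuousOn (fun t => u.rep t - û.rep t) (Icc 0 T) :=
    u.continuousOn_rep.sub û.continuousOn_rep
  rw [← massForm_self hc, timeMeasure,
    ← energy_identity hT (massForm_comm hc) herr hcdt_err hcont hrep hderiv, h0, sub_self,
    map_zero, sub_zero]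

variable {f : ℝ → ScalarL2 Ω} {g : ℝ → Lp ℝ 2 ((surfaceMeasure Ω).restrict Γq)}
  {u û : ParabolicSpace Ω Γu T c} {q : ℝ → VectorL2 Ω} {z : ℝ → ScalarL2 Ω}

theorem memLp_coe_fieldPair {α : Type*} {_ : MeasurableSpace α} {ν : Measure α} {v : α → V Ω Γu}
    (hv : MemLp v 2 ν) : MemLp (fun t => (v t : FieldPair Ω)) 2 ν :=
  (V Ω Γu).subtypeL.comp_memLp' hv

theorem IsAdmissible.memLp_toLp (hadm : IsAdmissible f g û q z) :
    MemLp (fun t => (WithLp.toLp 2 (z t, q t) : FieldPair Ω)) 2 (timeMeasure T) :=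
  MemLp.of_fst_of_snd_prodLp ⟨hadm.memLp_z, hadm.memLp_q⟩

theorem IsWeakSolution.integral_residual_eq_zero (hk : IsPositiveCoefficient Ω k)
    (hr : IsPositiveCoefficient Ω r) (hu : IsWeakSolution k r f g u)
    (hadm : IsAdmissible f g û q z) {v : ℝ → V Ω Γu} (hv : MemLp v 2 (timeMeasure T)) :
    ∫ t, (u.cdt t - û.cdt t) (v t) ∂timeMeasure T
      + ∫ t, ⟪constitutiveLaw hk hr (u.toFun t) - WithLp.toLp 2 (z t, q t), (v t : FieldPair Ω)⟫
        ∂timeMeasure T = 0 := by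
  have hvp := memLp_coe_fieldPair hv
  have hcdt {w : ParabolicSpace Ω Γu T c} :
      Integrable (fun t => w.cdt t (v t)) (timeMeasure T) :=
    integrable_apply_of_memLp_two w.memLp_cdt hv
  have hflux : Integrable (fun t => ⟪constitutiveLaw hk hr (u.toFun t), (v t : FieldPair Ω)⟫)
      (timeMeasure T) :=
    integrable_inner_of_memLp_two
      ((constitutiveLaw hk hr).comp_memLp' (memLp_coe_fieldPair u.memLp_toFun)) hvp
  have hbalance := integrable_inner_of_memLp_two hadm.memLp_toLp hvp
  have hweak : ∫ t, (u.cdt t (v t) + ⟪constitutiveLaw hk hr (u.toFun t), (v t : FieldPair Ω)⟫)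
      ∂timeMeasure T = ∫ t, load Γq (f t) (g t) (v t) ∂timeMeasure T := by
    simp only [inner_constitutiveLaw]
    exact hu.2 v hv
  have hequilibrium : ∫ t, (û.cdt t (v t) + ⟪WithLp.toLp 2 (z t, q t), (v t : FieldPair Ω)⟫)
      ∂timeMeasure T = ∫ t, load Γq (f t) (g t) (v t) ∂timeMeasure T := by
    refine integral_congr_ae ?_
    filter_upwards [hadm.equilibrium] with t ht
    rw [← ht (v t), inner_eq_integral_inner_add_mul]
    rfl
  simp only [sub_apply, inner_sub_left]
  rw [integral_sub hcdt hcdt, integral_sub hflux hbalance]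
  rw [← hequilibrium, integral_add hcdt hflux, integral_add hcdt hbalance] at hweak
  linarith

theorem IsWeakSolution.two_mul_integral_residual_error (hT : 0 < T)
    (hc : IsPositiveCoefficient Ω c) (hk : IsPositiveCoefficient Ω k)
    (hr : IsPositiveCoefficient Ω r) (hu : IsWeakSolution k r f g u)
    (hadm : IsAdmissible f g û q z) :
    2 * ∫ t, ⟪constitutiveLaw hk hr (u.toFun t) - WithLp.toLp 2 (z t, q t),
        (u.toFun t - û.toFun t : FieldPair Ω)⟫ ∂timeMeasure T
      = -normSq Ω c (u.rep T - û.rep T) := by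
  have hortho := hu.integral_residual_eq_zero hk hr hadm (u.memLp_toFun.sub û.memLp_toFun)
  simp only [Pi.sub_apply, AddSubgroupClass.coe_sub] at hortho
  rw [normSq_rep_sub_rep hT hc (hu.1.trans hadm.initial.symm)]
  linarith

theorem integral_inner_residual_eq_triNormSq (hk : IsPositiveCoefficient Ω k)
    (hr : IsPositiveCoefficient Ω r) {v : ℝ → V Ω Γu} (hv : MemLp v 2 (timeMeasure T))
    (hq : MemLp q 2 (timeMeasure T)) (hz : MemLp z 2 (timeMeasure T)) :
    ∫ t, ⟪constitutiveLaw hk.one_div hr.one_div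
          (constitutiveLaw hk hr (v t) - WithLp.toLp 2 (z t, q t)),
        constitutiveLaw hk hr (v t) - WithLp.toLp 2 (z t, q t)⟫ ∂timeMeasure T
      = triNormSq Ω T (fun x => 1 / k x) (fun t x => k x • grad (v t) x - q t x)
        + triNormSq Ω T (fun x => 1 / r x) (fun t x => r x * fn (v t) x - z t x) := by
  have hres : MemLp (fun t => constitutiveLaw hk hr (v t) - WithLp.toLp 2 (z t, q t)) 2
      (timeMeasure T) :=
    ((constitutiveLaw hk hr).comp_memLp' (memLp_coe_fieldPair hv)).sub
      (MemLp.of_fst_of_snd_prodLp ⟨hz, hq⟩)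
  rw [integral_inner_constitutiveLaw_self hk.one_div hr.one_div hres]
  congr 1
  · exact triNormSq_congr fun t => coeFn_mulLp_sub hk.memLp_top (grad (v t)) (q t)
  · exact triNormSq_congr fun t => coeFn_mulLp_sub hr.memLp_top (fn (v t)) (z t)

theorem integral_inner_averaged_residual_eq_triNormSq (hk : IsPositiveCoefficient Ω k)
    (hr : IsPositiveCoefficient Ω r) {v v' : ℝ → V Ω Γu} (hv : MemLp v 2 (timeMeasure T))
    (hv' : MemLp v' 2 (timeMeasure T)) (hq : MemLp q 2 (timeMeasure T))
    (hz : MemLp z 2 (timeMeasure T)) :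
    ∫ t, ⟪constitutiveLaw hk.one_div hr.one_div (constitutiveLaw hk hr (v t)
          - (1 / 2 : ℝ) • (WithLp.toLp 2 (z t, q t) + constitutiveLaw hk hr (v' t))),
        constitutiveLaw hk hr (v t)
          - (1 / 2 : ℝ) • (WithLp.toLp 2 (z t, q t) + constitutiveLaw hk hr (v' t))⟫ ∂timeMeasure T
      = triNormSq Ω T (fun x => 1 / k x)
          (fun t x => k x • grad (v t) x - (1 / 2 : ℝ) • (q t x + k x • grad (v' t) x))
        + triNormSq Ω T (fun x => 1 / r x)
          (fun t x => r x * fn (v t) x - (1 / 2 : ℝ) * (z t x + r x * fn (v' t) x)) := by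
  have hconst {v : ℝ → V Ω Γu} (hv : MemLp v 2 (timeMeasure T)) :
      MemLp (fun t => constitutiveLaw hk hr (v t)) 2 (timeMeasure T) :=
    (constitutiveLaw hk hr).comp_memLp' (memLp_coe_fieldPair hv)
  have hbalance : MemLp (fun t => (WithLp.toLp 2 (z t, q t) : FieldPair Ω)) 2 (timeMeasure T) :=
    MemLp.of_fst_of_snd_prodLp ⟨hz, hq⟩
  have hres : MemLp (fun t => constitutiveLaw hk hr (v t)
      - (1 / 2 : ℝ) • (WithLp.toLp 2 (z t, q t) + constitutiveLaw hk hr (v' t))) 2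
      (timeMeasure T) :=
    (hconst hv).sub ((hbalance.add (hconst hv')).const_smul (1 / 2 : ℝ))
  rw [integral_inner_constitutiveLaw_self hk.one_div hr.one_div hres]
  congr 1
  · exact triNormSq_congr fun t =>
      coeFn_mulLp_sub_average hk.memLp_top (grad (v t)) (grad (v' t)) (q t)
  · exact triNormSq_congr fun t =>
      coeFn_mulLp_sub_average hr.memLp_top (fn (v t)) (fn (v' t)) (z t)

theorem creSq_eq_add_triNormSq_add_normSq (hT : 0 < T) (hc : IsPositiveCoefficient Ω c)
    (hk : IsPositiveCoefficient Ω k) (hr : IsPositiveCoefficient Ω r)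
    (hu : IsWeakSolution k r f g u) (hadm : IsAdmissible f g û q z) :
    creSq T k r û.toFun (fun t => q t) (fun t => z t)
      = triNormSq Ω T (fun x => 1 / k x) (fun t x => k x • grad (u.toFun t) x - q t x)
        + triNormSq Ω T (fun x => 1 / r x) (fun t x => r x * fn (u.toFun t) x - z t x)
        + triNormSq Ω T k (fun t => grad (u.toFun t - û.toFun t))
        + triNormSq Ω T r (fun t => fn (u.toFun t - û.toFun t))
        + normSq Ω c (u.rep T - û.rep T) := by
  have hup := memLp_coe_fieldPair u.memLp_toFun
  have hûp := memLp_coe_fieldPair û.memLp_toFun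
  have herror : ∫ t, ⟪constitutiveLaw hk hr (u.toFun t - û.toFun t : FieldPair Ω),
      (u.toFun t - û.toFun t : FieldPair Ω)⟫ ∂timeMeasure T
      = triNormSq Ω T k (fun t => grad (u.toFun t - û.toFun t))
        + triNormSq Ω T r (fun t => fn (u.toFun t - û.toFun t)) :=
    integral_inner_constitutiveLaw_self hk hr (hup.sub hûp)
  rw [creSq_eq_integral_inner hk hr, integral_inner_residual
    (inner_constitutiveLaw_comm hk.one_div hr.one_div) (constitutiveLaw_one_div_leftInverse hk hr)
    hup hûp hadm.memLp_toLp, integral_inner_residual_eq_triNormSq hk hr u.memLp_toFun hadm.memLp_q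
    hadm.memLp_z, hu.two_mul_integral_residual_error hT hc hk hr hadm, herror]
  ring

theorem energyNormSq_le_creSq (hT : 0 < T) (hc : IsPositiveCoefficient Ω c)
    (hk : IsPositiveCoefficient Ω k) (hr : IsPositiveCoefficient Ω r)
    (hu : IsWeakSolution k r f g u) (hadm : IsAdmissible f g û q z) :
    energyNormSq T c k r (fun t => u.toFun t - û.toFun t) (u.rep T - û.rep T)
      ≤ creSq T k r û.toFun (fun t => q t) (fun t => z t) := by
  rw [creSq_eq_add_triNormSq_add_normSq hT hc hk hr hu hadm, energyNormSq]
  linarith [triNormSq_nonneg (T := T) hk.one_div fun t x => k x • grad (u.toFun t) x - q t x,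
    triNormSq_nonneg (T := T) hr.one_div fun t x => r x * fn (u.toFun t) x - z t x]

theorem half_mul_creSq_eq_average (hT : 0 < T) (hc : IsPositiveCoefficient Ω c)
    (hk : IsPositiveCoefficient Ω k) (hr : IsPositiveCoefficient Ω r)
    (hu : IsWeakSolution k r f g u) (hadm : IsAdmissible f g û q z) :
    (1 / 2 : ℝ) * creSq T k r û.toFun (fun t => q t) (fun t => z t)
      = 2 * triNormSq Ω T (fun x => 1 / k x)
          (fun t x => k x • grad (u.toFun t) x - (1 / 2 : ℝ) • (q t x + k x • grad (û.toFun t) x))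
        + 2 * triNormSq Ω T (fun x => 1 / r x)
          (fun t x => r x * fn (u.toFun t) x - (1 / 2 : ℝ) * (z t x + r x * fn (û.toFun t) x))
        + normSq Ω c (u.rep T - û.rep T) := by
  have haverage := integral_inner_averaged_residual
    (inner_constitutiveLaw_comm hk.one_div hr.one_div) (constitutiveLaw_one_div_leftInverse hk hr)
    (memLp_coe_fieldPair u.memLp_toFun) (memLp_coe_fieldPair û.memLp_toFun) hadm.memLp_toLp
  rw [integral_inner_averaged_residual_eq_triNormSq hk hr u.memLp_toFun û.memLp_toFun
    hadm.memLp_q hadm.memLp_z, ← creSq_eq_integral_inner] at haverage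
  linarith [hu.two_mul_integral_residual_error hT hc hk hr hadm]

end Parabolic

section PGD

theorem memLp_sum_smul {α X ι : Type*} {_ : MeasurableSpace α} {ν : Measure α} {p : ENNReal}
    [NormedAddCommGroup X] [NormedSpace ℝ X] {I : Finset ι} {s : ι → α → ℝ}
    (hs : ∀ i ∈ I, MemLp (s i) p ν) (v : ι → X) : MemLp (fun t => ∑ i ∈ I, s i t • v i) p ν :=
  memLp_finsetSum _ fun i hi =>
    (ContinuousLinearMap.toSpanSingleton ℝ (v i)).comp_memLp' (hs i hi)

theorem memLp_bilinearComp {α X X' Y Y' : Type*} {_ : MeasurableSpace α} {ν : Measure α}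
    {p : ENNReal} [NormedAddCommGroup X] [NormedSpace ℝ X] [NormedAddCommGroup X']
    [NormedSpace ℝ X'] [NormedAddCommGroup Y] [NormedSpace ℝ Y] [NormedAddCommGroup Y']
    [NormedSpace ℝ Y'] (B : Y →L[ℝ] Y' →L[ℝ] ℝ) (j : X →L[ℝ] Y) (j' : X' →L[ℝ] Y') {w : α → X}
    (hw : MemLp w p ν) : MemLp (fun t => B.bilinearComp j j' (w t)) p ν :=
  (B.bilinearComp j j').comp_memLp' hw

theorem memLp_of_continuousOn_Icc {l : ℝ → ℝ} {a b : ℝ} {p : ENNReal}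
    (hl : ContinuousOn l (Icc a b)) : MemLp l p (volume.restrict (Icc a b)) := by
  obtain ⟨C, hC⟩ := isCompact_Icc.exists_bound_of_continuousOn hl
  refine MemLp.of_bound (hl.aestronglyMeasurable measurableSet_Icc) C ?_
  filter_upwards [ae_restrict_mem measurableSet_Icc] with t ht using hC t ht

variable {d np m : ℕ} {Ω Γu Γq : Set (Space d)} {T : ℝ} {P : Fin np → Set ℝ} {c k r : Space d → ℝ}

namespace PGDApproximation

variable (U : PGDApproximation Ω Γu T P m) (p : Fin np → ℝ)

theorem continuousOn_time (hT : 0 < T) (i : Fin m) : ContinuousOn (U.time i) (Icc 0 T) := by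
  simpa only [uIcc_of_le hT.le] using (U.time_ac i).continuousOn

theorem continuousOn_eval (hT : 0 < T) : ContinuousOn (U.eval p) (Icc 0 T) :=
  continuousOn_finsetSum _ fun i _ =>
    ((U.continuousOn_time hT i).mul continuousOn_const).smul continuousOn_const

theorem memLp_eval (hT : 0 < T) : MemLp (U.eval p) 2 (timeMeasure T) :=
  memLp_sum_smul
    (fun i _ => (memLp_of_continuousOn_Icc (U.continuousOn_time hT i)).mul_const _) U.space

theorem memLp_evalDeriv : MemLp (U.evalDeriv p) 2 (timeMeasure T) :=
  memLp_sum_smul (fun i _ => (U.time_deriv i).mul_const _) U.space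

theorem hasWeakDeriv_eval (hT : 0 < T) (L : StrongDual ℝ (V Ω Γu)) :
    HasWeakDeriv 0 T (fun t => L (U.eval p t)) fun t => L (U.evalDeriv p t) := by
  simp only [eval, evalDeriv, map_sum, map_smul, smul_eq_mul, mul_assoc]
  exact .sum
    (fun i _ => (HasWeakDeriv.of_absolutelyContinuousOnInterval hT.le (U.time_ac i)).mul_const _)
    (fun i _ => ((U.continuousOn_time hT i).mul continuousOn_const).integrableOn_Icc)
    fun i _ => (MemLp.integrable one_le_two (μ := volume.restrict (Icc 0 T))
      (U.time_deriv i)).mul_const _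

/-- A separated approximation, for a fixed value of the parameters, as an element of the parabolic
space; `c ∂u_m/∂t` is the functional `v ↦ ∫_Ω c ∂u_m/∂t v`. -/
noncomputable def toParabolicSpace (hT : 0 < T) (hc : IsPositiveCoefficient Ω c) :
    ParabolicSpace Ω Γu T c where
  toFun := U.eval p
  cdt t := (massForm hc).bilinearComp (fnL Ω Γu) (fnL Ω Γu) (U.evalDeriv p t)
  rep t := fn (U.eval p t)
  memLp_toFun := U.memLp_eval p hT
  memLp_cdt := memLp_bilinearComp (massForm hc) (fnL Ω Γu) (fnL Ω Γu) (U.memLp_evalDeriv p)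
  continuousOn_rep := (fnL Ω Γu).continuous.comp_continuousOn (U.continuousOn_eval p hT)
  rep_ae_eq := .of_forall fun _ => rfl
  weak_derivative φ hsmooth hcompact hsupport v := by
    simp only [← massForm_apply hc]
    exact U.hasWeakDeriv_eval p hT (((massForm hc).flip (fn v)) ∘L fnL Ω Γu) φ
      ⟨hsmooth, hcompact, hsupport⟩

theorem toParabolicSpace_cdt_apply (hT : 0 < T) (hc : IsPositiveCoefficient Ω c) (t : ℝ)
    (v : V Ω Γu) :
    (U.toParabolicSpace p hT hc).cdt t v = ∫ x in Ω, c x * fn (U.evalDeriv p t) x * fn v x :=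
  massForm_apply hc (fn (U.evalDeriv p t)) (fn v)

end PGDApproximation

theorem IsPositiveCoefficient.integrable_mul_mul {w : Space d → ℝ} (hw : IsPositiveCoefficient Ω w)
    (A B : ScalarL2 Ω) : Integrable (fun x => w x * A x * B x) (volume.restrict Ω) :=
  (MemLp.mul (r := 2) (Lp.memLp A) hw.memLp_top).integrable_mul (Lp.memLp B)

variable {f : ℝ → ScalarL2 Ω} {g : ℝ → Lp ℝ 2 ((surfaceMeasure Ω).restrict Γq)}
  {U : PGDApproximation Ω Γu T P m} {p : Fin np → ℝ} {q : ℝ → VectorL2 Ω}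

theorem IsEquilibratedFlux.isAdmissible (hq : IsEquilibratedFlux c r f g U p q) (hT : 0 < T)
    (hp : p ∈ univ.pi P) (hc : IsPositiveCoefficient Ω c) (hr : IsPositiveCoefficient Ω r) :
    IsAdmissible f g (U.toParabolicSpace p hT hc) q
      (fun t => mulLp hr.memLp_top (fn (U.eval p t))) where
  initial := congrArg fn (U.initial p hp)
  memLp_q := hq.memLp_q
  memLp_z := (mulLp hr.memLp_top ∘L fnL Ω Γu).comp_memLp' (U.memLp_eval p hT)
  equilibrium := by
    filter_upwards [hq.equilibrium] with t ht v
    have hreaction : Integrable (fun x => mulLp hr.memLp_top (fn (U.eval p t)) x * fn v x)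
        (volume.restrict Ω) :=
      (Lp.memLp _).integrable_mul (Lp.memLp _)
    rw [← ht v, U.toParabolicSpace_cdt_apply, ← integral_add (hc.integrable_mul_mul _ _)
      ((L2.integrable_inner (q t) (grad v)).fun_add hreaction)]
    refine integral_congr_ae ?_
    filter_upwards [coeFn_mulLp hr.memLp_top (fn (U.eval p t))] with x hx
    rw [hx, smul_eq_mul, add_assoc]

theorem creSq_mulLp (hr : IsPositiveCoefficient Ω r) (û : ℝ → V Ω Γu) (q : ℝ → Space d → Space d) :
    creSq T k r û q (fun t => mulLp hr.memLp_top (fn (û t)))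
      = creSq T k r û q (fun t x => r x * fn (û t) x) := by
  refine integral_congr_ae (.of_forall fun t => integral_congr_ae ?_)
  filter_upwards [coeFn_mulLp hr.memLp_top (fn (û t))] with x hx
  rw [hx, smul_eq_mul]

theorem creSq_eq_triNormSq (û : ℝ → V Ω Γu) (q : ℝ → Space d → Space d) :
    creSq T k r û q (fun t x => r x * fn (û t) x)
      = triNormSq Ω T (fun x => 1 / k x) (fun t x => q t x - k x • grad (û t) x) := by
  simp [creSq, triNormSq, normSq]

theorem IsEquilibratedFlux.energyNormSq_le_creSq {u : ParabolicSpace Ω Γu T c}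
    (hq : IsEquilibratedFlux c r f g U p q) (hT : 0 < T) (hp : p ∈ univ.pi P)
    (hc : IsPositiveCoefficient Ω c) (hk : IsPositiveCoefficient Ω k)
    (hr : IsPositiveCoefficient Ω r) (hu : IsWeakSolution k r f g u) :
    energyNormSq T c k r (fun t => u.toFun t - U.eval p t) (u.rep T - fn (U.eval p T))
      ≤ creSq T k r (U.eval p) (fun t => q t) (fun t x => r x * fn (U.eval p t) x) :=
  (CRE.energyNormSq_le_creSq hT hc hk hr hu (hq.isAdmissible hT hp hc hr)).trans_eq
    (creSq_mulLp hr (U.eval p) fun t => q t)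

end PGD

end CRE

theorem mainTheorem1_general {d np : ℕ} (Ω Γu Γq : Set (Space d)) (T : ℝ) (hT : 0 < T)
    (P : Fin np → Set ℝ) (c k r : Space d → (Fin np → ℝ) → ℝ)
    (hc : ∀ p ∈ Set.univ.pi P, IsPositiveCoefficient Ω (fun x => c x p))
    (hk : ∀ p ∈ Set.univ.pi P, IsPositiveCoefficient Ω (fun x => k x p))
    (hr : ∀ p ∈ Set.univ.pi P, IsPositiveCoefficient Ω (fun x => r x p))
    (f : ℝ → ScalarL2 Ω) (g : ℝ → Lp ℝ 2 ((surfaceMeasure Ω).restrict Γq))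
    (u : ∀ p : Fin np → ℝ, ParabolicSpace Ω Γu T (fun x => c x p))
    (hu : ∀ p ∈ Set.univ.pi P, IsWeakSolution (fun x => k x p) (fun x => r x p) f g (u p)) :
    (∀ p ∈ Set.univ.pi P, ∀ (û : ParabolicSpace Ω Γu T (fun x => c x p))
      (qh : ℝ → VectorL2 Ω) (zh : ℝ → ScalarL2 Ω), IsAdmissible f g û qh zh →
      creSq T (fun x => k x p) (fun x => r x p) û.toFun (fun t => qh t) (fun t => zh t)
        = triNormSq Ω T (fun x => 1 / k x p)
            (fun t x => k x p • grad ((u p).toFun t) x - qh t x)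
          + triNormSq Ω T (fun x => 1 / r x p)
            (fun t x => r x p * fn ((u p).toFun t) x - zh t x)
          + triNormSq Ω T (fun x => k x p) (fun t => grad ((u p).toFun t - û.toFun t))
          + triNormSq Ω T (fun x => r x p) (fun t => fn ((u p).toFun t - û.toFun t))
          + normSq Ω (fun x => c x p) ((u p).rep T - û.rep T)
      ∧ creSq T (fun x => k x p) (fun x => r x p) û.toFun (fun t => qh t) (fun t => zh t)
        ≥ energyNormSq T (fun x => c x p) (fun x => k x p) (fun x => r x p)
            (fun t => (u p).toFun t - û.toFun t) ((u p).rep T - û.rep T)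
      ∧ (1 / 2 : ℝ) *
          creSq T (fun x => k x p) (fun x => r x p) û.toFun (fun t => qh t) (fun t => zh t)
        = 2 * triNormSq Ω T (fun x => 1 / k x p)
            (fun t x => k x p • grad ((u p).toFun t) x
              - (1 / 2 : ℝ) • (qh t x + k x p • grad (û.toFun t) x))
          + 2 * triNormSq Ω T (fun x => 1 / r x p)
            (fun t x => r x p * fn ((u p).toFun t) x
              - (1 / 2 : ℝ) * (zh t x + r x p * fn (û.toFun t) x))
          + normSq Ω (fun x => c x p) ((u p).rep T - û.rep T))
    ∧
    (∀ (m : ℕ) (U : PGDApproximation Ω Γu T P m) (qm : (Fin np → ℝ) → ℝ → VectorL2 Ω),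
      (∀ p ∈ Set.univ.pi P,
        IsEquilibratedFlux (fun x => c x p) (fun x => r x p) f g U p (qm p)) →
      ∀ p ∈ Set.univ.pi P,
        creSq T (fun x => k x p) (fun x => r x p) (U.eval p) (fun t => qm p t)
            (fun t x => r x p * fn (U.eval p t) x)
          = triNormSq Ω T (fun x => 1 / k x p)
              (fun t x => qm p t x - k x p • grad (U.eval p t) x)
        ∧ creSq T (fun x => k x p) (fun x => r x p) (U.eval p) (fun t => qm p t)
            (fun t x => r x p * fn (U.eval p t) x)
          ≥ energyNormSq T (fun x => c x p) (fun x => k x p) (fun x => r x p)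
              (fun t => (u p).toFun t - U.eval p t) ((u p).rep T - fn (U.eval p T))) :=
  ⟨fun p hp _ _ _ hadm =>
      have hcp := hc p hp
      have hkp := hk p hp
      have hrp := hr p hp
      ⟨creSq_eq_add_triNormSq_add_normSq hT hcp hkp hrp (hu p hp) hadm,
        energyNormSq_le_creSq hT hcp hkp hrp (hu p hp) hadm,
        half_mul_creSq_eq_average hT hcp hkp hrp (hu p hp) hadm⟩,
    fun _ U qm hqm p hp =>
      ⟨creSq_eq_triNormSq (U.eval p) fun t => qm p t,
        (hqm p hp).energyNormSq_le_creSq hT hp (hc p hp) (hk p hp) (hr p hp) (hu p hp)⟩⟩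

theorem mainTheorem1 {d np : ℕ} (Ω Γu Γq : Set (Space d)) (hΩ : IsLipschitzDomain Ω)
    (hΓu : Γu ⊆ frontier Ω) (hΓq : Γq ⊆ frontier Ω) (hΓu_ne : Γu.Nonempty)
    (hΓ_disj : Disjoint Γu Γq) (hΓ_cover : closure (Γu ∪ Γq) = frontier Ω)
    (hΓu_meas : MeasurableSet Γu) (hΓq_meas : MeasurableSet Γq)
    (T : ℝ) (hT : 0 < T)
    (P : Fin np → Set ℝ) (hP : ∀ j, Bornology.IsBounded (P j))
    (c k r : Space d → (Fin np → ℝ) → ℝ)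
    (hc : ∀ p ∈ Set.univ.pi P, IsPositiveCoefficient Ω (fun x => c x p))
    (hk : ∀ p ∈ Set.univ.pi P, IsPositiveCoefficient Ω (fun x => k x p))
    (hr : ∀ p ∈ Set.univ.pi P, IsPositiveCoefficient Ω (fun x => r x p))
    (f : ℝ → ScalarL2 Ω) (hf : MemLp f 2 (timeMeasure T))
    (g : ℝ → Lp ℝ 2 ((surfaceMeasure Ω).restrict Γq)) (hg : MemLp g 2 (timeMeasure T))
    (u : ∀ p : Fin np → ℝ, ParabolicSpace Ω Γu T (fun x => c x p))
    (hu : ∀ p ∈ Set.univ.pi P, IsWeakSolution (fun x => k x p) (fun x => r x p) f g (u p)) :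
    -- Extended Prager-Synge equality, inequality, and equality with averaged fluxes
    (∀ p ∈ Set.univ.pi P, ∀ (û : ParabolicSpace Ω Γu T (fun x => c x p))
      (qh : ℝ → VectorL2 Ω) (zh : ℝ → ScalarL2 Ω), IsAdmissible f g û qh zh →
      creSq T (fun x => k x p) (fun x => r x p) û.toFun (fun t => qh t) (fun t => zh t)
        = triNormSq Ω T (fun x => 1 / k x p)
            (fun t x => k x p • grad ((u p).toFun t) x - qh t x)
          + triNormSq Ω T (fun x => 1 / r x p)
            (fun t x => r x p * fn ((u p).toFun t) x - zh t x)
          + triNormSq Ω T (fun x => k x p) (fun t => grad ((u p).toFun t - û.toFun t))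
          + triNormSq Ω T (fun x => r x p) (fun t => fn ((u p).toFun t - û.toFun t))
          + normSq Ω (fun x => c x p) ((u p).rep T - û.rep T)
      ∧ creSq T (fun x => k x p) (fun x => r x p) û.toFun (fun t => qh t) (fun t => zh t)
        ≥ energyNormSq T (fun x => c x p) (fun x => k x p) (fun x => r x p)
            (fun t => (u p).toFun t - û.toFun t) ((u p).rep T - û.rep T)
      ∧ (1 / 2 : ℝ) *
          creSq T (fun x => k x p) (fun x => r x p) û.toFun (fun t => qh t) (fun t => zh t)
        = 2 * triNormSq Ω T (fun x => 1 / k x p)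
            (fun t x => k x p • grad ((u p).toFun t) x
              - (1 / 2 : ℝ) • (qh t x + k x p • grad (û.toFun t) x))
          + 2 * triNormSq Ω T (fun x => 1 / r x p)
            (fun t x => r x p * fn ((u p).toFun t) x
              - (1 / 2 : ℝ) * (zh t x + r x p * fn (û.toFun t) x))
          + normSq Ω (fun x => c x p) ((u p).rep T - û.rep T))
    ∧
    -- Guaranteed error bound for the PGD approximation with an equilibrated flux
    (∀ (m : ℕ) (U : PGDApproximation Ω Γu T P m) (qm : (Fin np → ℝ) → ℝ → VectorL2 Ω),
      (∀ p ∈ Set.univ.pi P,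
        IsEquilibratedFlux (fun x => c x p) (fun x => r x p) f g U p (qm p)) →
      ∀ p ∈ Set.univ.pi P,
        creSq T (fun x => k x p) (fun x => r x p) (U.eval p) (fun t => qm p t)
            (fun t x => r x p * fn (U.eval p t) x)
          = triNormSq Ω T (fun x => 1 / k x p)
              (fun t x => qm p t x - k x p • grad (U.eval p t) x)
        ∧ creSq T (fun x => k x p) (fun x => r x p) (U.eval p) (fun t => qm p t)
            (fun t x => r x p * fn (U.eval p t) x)
          ≥ energyNormSq T (fun x => c x p) (fun x => k x p) (fun x => r x p)
              (fun t => (u p).toFun t - U.eval p t) ((u p).rep T - fn (U.eval p T))) :=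
  mainTheorem1_general Ω Γu Γq T hT P c k r hc hk hr f g u hu
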